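/- Let $l>0$, $0<\sigma<\tfrac12$, $S>0$, $P\in\mathbb R$, and $\Omega=(0,\pi)\times(-l,l)$. Let $H^2_*(\Omega)=\{u\in H^2(\Omega): u=0\text{ on }\{0,\pi\}\times[-l,l]\}$, let $(\cdot,\cdot)_0$ be the inner product of $L^2(\Omega)$, with norm $\|\cdot\|_0$, and set $$(u,v)_2=\int_\Omega\Delta u\,\Delta v-(1-\sigma)\big(u_{xx}v_{yy}+u_{yy}v_{xx}-2u_{xy}v_{xy}\big).$$ For integers $m,i\ge1$ let $\Lambda_{m,i}$ be the $i$-th eigenvalue, in nondecreasing order and counted with multiplicity, of the buckling problem $$\Delta^2w+\Lambda w_{xx}=0\text{ in }\Omega,\quad w=w_{xx}=0\text{ on }\{0,\pi\}\times[-l,l],\quad w_{yy}+\sigma w_{xx}=w_{yyy}+(2-\sigma)w_{xxy}=0\text{ on }[0,\pi]\times\{-l,l\}$$ (in weak form: $w\in H^2_*(\Omega)$ and $(w,z)_2=\Lambda(w_x,z_x)_0$ for all $z\in H^2_*(\Omega)$) among eigenfunctions of the form $w(x,y)=\eta(y)\sin(mx)$, and let $w_{m,i}$ be any eigenfunction of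 this form with eigenvalue $\Lambda_{m,i}$ and $\|w_{m,i}\|_0=1$. An $(m,i)$-simple mode is a function $U(x,y,t)=\varphi(t)\,w_{m,i}(x,y)$ with $\varphi\in C^2([0,\infty),\mathbb R)$ which, on every $[0,T]$, is a weak solution, with $F\equiv0$ and $\delta=0$, of $$U_{tt}+\delta U_t+\Delta^2U-\phi(U)U_{xx}=F,\qquad \phi(U)=-P+S\int_\Omega U_x^2,$$ with $U=U_{xx}=0$ on $\{0,\pi\}\times[-l,l]$ and $U_{yy}+\sigma U_{xx}=U_{yyy}+(2-\sigma)U_{xxy}=0$ on $[0,\pi]\times\{-l,l\}$; a weak solution is a function $U\in C^0([0,T],H^2_*(\Omega))\cap C^1([0,T],L^2(\Omega))\cap C^2([0,T],H^2_*(\Omega)')$ with the prescribed initial data and with $\langle U'',V\rangle+\delta(U',V)_0+(U,V)_2+\phi(U)(U_x,V_x)_0=(F,V)_0$ for all $t\in[0,T]$ and $V\in H^2_*(\Omega)$. The energy of the mode is $$E_0=\frac{\varphi'(0)^2}2+m^2(\Lambda_{m,i}-P)\frac{\varphi(0)^2}2+S\,\frac{m^4\varphi(0)^4}4 .$$ For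 integers $n,k\ge1$ the mode is called $(n,k)$ linearly stable if $\xi\equiv0$ is a (Lyapunov) stable solution, on $t\ge0$, of the Hill equation $$\xi''+a(t)\xi=0,\qquad a(t)=n^2(\Lambda_{n,k}-P)+Sm^2n^2\varphi(t)^2,$$ equivalently, if all solutions of this equation are bounded on $[0,\infty)$; otherwise it is called $(n,k)$ linearly unstable. Theorem. Let $m,n,i,k\ge1$ be integers with $P<\min\{\Lambda_{m,i},\Lambda_{n,k}\}$, and set $\gamma=n^2/m^2$. For $j\in\mathbb N\cup\{0\}$ let $I_j=\big(j(2j+1),(j+1)(2j+1)\big)$ and $K_j=\big((j+1)(2j+1),(j+1)(2j+3)\big)$. (i) If $\gamma\in I_j$ for some $j\in\mathbb N\cup\{0\}$, then there is $E^*$ such that every $(m,i)$-simple mode with energy $E_0\ge E^*$ is $(n,k)$ linearly stable; in particular all solutions of its Hill equation are bounded. (ii) If $\gamma\in K_j$ for some $j\in\mathbb N\cup\{0\}$, then there is $E^*$ such that every $(m,i)$-simple mode with energy $E_0\ge E^*$ is $(n,k)$ linearly unstable; in particular its Hill equation has an unbounded solution. -/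

import Mathlib

open MeasureTheory Set

noncomputable section

namespace Plate

/-- The open rectangle `(0, π) × (-l, l)`. -/
def rect (l : ℝ) : Set (ℝ × ℝ) := Ioo 0 Real.pi ×ˢ Ioo (-l) l

/-- Lebesgue measure on the rectangle. -/
def rectMeasure (l : ℝ) : Measure (ℝ × ℝ) := volume.restrict (rect l)

instance instIsFiniteMeasureRect (l : ℝ) : IsFiniteMeasure (rectMeasure l) := by
  refine ⟨?_⟩
  rw [rectMeasure, Measure.restrict_apply_univ, rect, Measure.volume_eq_prod, Measure.prod_prod]
  simp [ENNReal.mul_lt_top]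

/-- The real Hilbert space `L²` of the rectangle. -/
abbrev L2 (l : ℝ) : Type := Lp ℝ 2 (rectMeasure l)

/-- Test functions: smooth, with compact support inside the open rectangle. -/
def IsTest (l : ℝ) (ψ : ℝ × ℝ → ℝ) : Prop :=
  ContDiff ℝ (⊤ : ℕ∞) ψ ∧ HasCompactSupport ψ ∧ tsupport ψ ⊆ rect l

/-- `g` is the weak derivative of `f` on the rectangle in the direction `v`
(`v = (1, 0)` gives `∂/∂x`, `v = (0, 1)` gives `∂/∂y`). -/
def IsWeakDeriv (l : ℝ) (v : ℝ × ℝ) (f g : L2 l) : Prop :=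
  ∀ ψ : ℝ × ℝ → ℝ, IsTest l ψ →
    ∫ p, f p * fderiv ℝ ψ p v ∂(rectMeasure l) = - ∫ p, g p * ψ p ∂(rectMeasure l)

/-- `f` has a representative which is continuous on the closed rectangle and vanishes on the two
short edges `{0, π} × [-l, l]`. (In two dimensions functions in `H²` of the rectangle are
continuous up to the boundary.) -/
def VanishesOnShortEdges (l : ℝ) (f : L2 l) : Prop :=
  ∃ g : ℝ × ℝ → ℝ, ContinuousOn g (Icc 0 Real.pi ×ˢ Icc (-l) l) ∧
    (∀ y ∈ Icc (-l) l, g (0, y) = 0 ∧ g (Real.pi, y) = 0) ∧ f =ᵐ[rectMeasure l] g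

theorem integrable_mul_of_continuous {l : ℝ} (f : L2 l) {h : ℝ × ℝ → ℝ}
    (hc : Continuous h) (hs : HasCompactSupport h) :
    Integrable (fun p => f p * h p) (rectMeasure l) := by
  obtain ⟨C, hC⟩ := hs.exists_bound_of_continuous hc
  have hf : Integrable f (rectMeasure l) := (Lp.memLp f).integrable (by norm_num)
  exact hf.mul_bdd (c := C) hc.aestronglyMeasurable (Filter.Eventually.of_forall hC)

theorem IsTest.integrable_mul {l : ℝ} {ψ : ℝ × ℝ → ℝ} (h : IsTest l ψ) (f : L2 l) :
    Integrable (fun p => f p * ψ p) (rectMeasure l) :=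
  integrable_mul_of_continuous f h.1.continuous h.2.1

theorem IsTest.integrable_mul_fderiv {l : ℝ} {ψ : ℝ × ℝ → ℝ} (h : IsTest l ψ) (v : ℝ × ℝ)
    (f : L2 l) : Integrable (fun p => f p * fderiv ℝ ψ p v) (rectMeasure l) :=
  integrable_mul_of_continuous f
    ((h.1.continuous_fderiv (by simp)).clm_apply continuous_const)
    (h.2.1.fderiv_apply (𝕜 := ℝ) v)

theorem IsWeakDeriv.zero (l : ℝ) (v : ℝ × ℝ) : IsWeakDeriv l v 0 0 := by
  intro ψ _
  have h0 : ((0 : L2 l) : ℝ × ℝ → ℝ) =ᵐ[rectMeasure l] 0 := Lp.coeFn_zero _ _ _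
  have e1 : ∫ p, (0 : L2 l) p * fderiv ℝ ψ p v ∂(rectMeasure l) = 0 :=
    integral_eq_zero_of_ae (by filter_upwards [h0] with p hp; rw [hp]; simp)
  have e2 : ∫ p, (0 : L2 l) p * ψ p ∂(rectMeasure l) = 0 :=
    integral_eq_zero_of_ae (by filter_upwards [h0] with p hp; rw [hp]; simp)
  rw [e1, e2, neg_zero]

theorem IsWeakDeriv.add {l : ℝ} {v : ℝ × ℝ} {f g f' g' : L2 l} (h : IsWeakDeriv l v f g)
    (h' : IsWeakDeriv l v f' g') : IsWeakDeriv l v (f + f') (g + g') := by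
  intro ψ hψ
  have e1 : ∫ p, (f + f') p * fderiv ℝ ψ p v ∂(rectMeasure l)
      = ∫ p, (f p * fderiv ℝ ψ p v + f' p * fderiv ℝ ψ p v) ∂(rectMeasure l) :=
    integral_congr_ae (by
      filter_upwards [Lp.coeFn_add f f'] with p hp
      rw [hp, Pi.add_apply, add_mul])
  have e2 : ∫ p, (g + g') p * ψ p ∂(rectMeasure l)
      = ∫ p, (g p * ψ p + g' p * ψ p) ∂(rectMeasure l) :=
    integral_congr_ae (by
      filter_upwards [Lp.coeFn_add g g'] with p hp
      rw [hp, Pi.add_apply, add_mul])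
  rw [e1, e2, integral_add (hψ.integrable_mul_fderiv v f) (hψ.integrable_mul_fderiv v f'),
    integral_add (hψ.integrable_mul g) (hψ.integrable_mul g'), h ψ hψ, h' ψ hψ, neg_add]

theorem IsWeakDeriv.smul {l : ℝ} {v : ℝ × ℝ} {f g : L2 l} (c : ℝ) (h : IsWeakDeriv l v f g) :
    IsWeakDeriv l v (c • f) (c • g) := by
  intro ψ hψ
  have e1 : ∫ p, (c • f) p * fderiv ℝ ψ p v ∂(rectMeasure l)
      = ∫ p, c * (f p * fderiv ℝ ψ p v) ∂(rectMeasure l) :=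
    integral_congr_ae (by
      filter_upwards [Lp.coeFn_smul c f] with p hp
      rw [hp, Pi.smul_apply, smul_eq_mul, mul_assoc])
  have e2 : ∫ p, (c • g) p * ψ p ∂(rectMeasure l) = ∫ p, c * (g p * ψ p) ∂(rectMeasure l) :=
    integral_congr_ae (by
      filter_upwards [Lp.coeFn_smul c g] with p hp
      rw [hp, Pi.smul_apply, smul_eq_mul, mul_assoc])
  rw [e1, e2, integral_const_mul, integral_const_mul, h ψ hψ, mul_neg]

/-- The space `H²_*` of the rectangle, as a subspace of `(L²)⁶`: functions in `H²` vanishing on the two short edges.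
An element is stored as the tuple `(u, u_x, u_y, u_xx, u_xy, u_yy)` of a function in `L²` and its
weak derivatives, and carries the usual norm of `H²` (the square root of the sum of the squares of
the `L²` norms of these six functions). -/
def H2starSubmodule (l : ℝ) : Submodule ℝ (PiLp 2 (fun _ : Fin 6 => L2 l)) where
  carrier := {u | IsWeakDeriv l (1, 0) (u 0) (u 1) ∧ IsWeakDeriv l (0, 1) (u 0) (u 2) ∧
    IsWeakDeriv l (1, 0) (u 1) (u 3) ∧ IsWeakDeriv l (0, 1) (u 1) (u 4) ∧
    IsWeakDeriv l (0, 1) (u 2) (u 5) ∧ VanishesOnShortEdges l (u 0)}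
  zero_mem' := by
    refine ⟨.zero l _, .zero l _, .zero l _, .zero l _, .zero l _, 0, continuousOn_const, ?_, ?_⟩
    · simp
    · exact Lp.coeFn_zero _ _ _
  add_mem' := by
    rintro a b ⟨a1, a2, a3, a4, a5, f, hf, hf0, haf⟩ ⟨b1, b2, b3, b4, b5, g, hg, hg0, hbg⟩
    refine ⟨a1.add b1, a2.add b2, a3.add b3, a4.add b4, a5.add b5, f + g, hf.add hg, ?_, ?_⟩
    · intro y hy
      simp [hf0 y hy, hg0 y hy]
    · exact (Lp.coeFn_add (a 0) (b 0)).trans (haf.add hbg)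
  smul_mem' := by
    rintro c a ⟨a1, a2, a3, a4, a5, f, hf, hf0, haf⟩
    refine ⟨a1.smul c, a2.smul c, a3.smul c, a4.smul c, a5.smul c, c • f, hf.const_smul c, ?_, ?_⟩
    · intro y hy
      simp [hf0 y hy]
    · exact (Lp.coeFn_smul c (a 0)).trans (haf.const_smul c)

/-- The space `H²_*` of the rectangle, as a Hilbert space with the inner product of `H²`. -/
def H2star (l : ℝ) : Type := H2starSubmodule l

instance instNormedAddCommGroupH2star (l : ℝ) : NormedAddCommGroup (H2star l) :=
  inferInstanceAs (NormedAddCommGroup (H2starSubmodule l))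

instance instInnerProductSpaceH2star (l : ℝ) : InnerProductSpace ℝ (H2star l) :=
  inferInstanceAs (InnerProductSpace ℝ (H2starSubmodule l))

/-- The `j`-th component of an element of `H²_*`. -/
def component (l : ℝ) (j : Fin 6) : H2star l →L[ℝ] L2 l :=
  (PiLp.proj (𝕜 := ℝ) 2 (fun _ : Fin 6 => L2 l) j).comp (H2starSubmodule l).subtypeL

/-- The embedding of `H²_*` into `L²`. -/
abbrev toL2 {l : ℝ} (u : H2star l) : L2 l := component l 0 u

/-- The weak derivative `u_x`. -/
abbrev dx {l : ℝ} (u : H2star l) : L2 l := component l 1 u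

/-- The weak derivative `u_xx`. -/
abbrev dxx {l : ℝ} (u : H2star l) : L2 l := component l 3 u

/-- The weak derivative `u_xy`. -/
abbrev dxy {l : ℝ} (u : H2star l) : L2 l := component l 4 u

/-- The weak derivative `u_yy`. -/
abbrev dyy {l : ℝ} (u : H2star l) : L2 l := component l 5 u

/-- The inner product
`(u, v)_2 = ∫ Δu Δv - (1 - σ) (u_xx v_yy + u_yy v_xx - 2 u_xy v_xy)` of `H²_*`. -/
def form2 {l : ℝ} (σ : ℝ) (u v : H2star l) : ℝ :=
  inner ℝ (dxx u + dyy u) (dxx v + dyy v)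
    - (1 - σ) * (inner ℝ (dxx u) (dyy v) + inner ℝ (dyy u) (dxx v)
      - 2 * inner ℝ (dxy u) (dxy v))

/-- The functional `v ↦ (f, v)_0` on `H²_*` given by `f` in `L²`: this is the embedding of `L²`
into the dual space of `H²_*`. -/
def toDual {l : ℝ} (f : L2 l) : StrongDual ℝ (H2star l) :=
  (innerSL ℝ f).comp (component l 0)

/-- Weak solutions on `[0, T]` of the plate equation
`U_tt + δ U_t + Δ²U - φ(U) U_xx = F`, `φ(U) = -P + S ∫ U_x²`, hinged on the short edges and free on
the long edges, with initial data `U₀`, `V₀`. -/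
structure IsWeakSolution {l : ℝ} (σ P S δ T : ℝ) (F : ℝ → L2 l) (U₀ : H2star l) (V₀ : L2 l)
    (U : ℝ → H2star l) : Prop where
  continuousOn : ContinuousOn U (Icc 0 T)
  contDiffOn_one : ContDiffOn ℝ 1 (fun t => toL2 (U t)) (Icc 0 T)
  contDiffOn_two : ContDiffOn ℝ 2 (fun t => toDual (toL2 (U t))) (Icc 0 T)
  initial : U 0 = U₀
  initial_velocity : derivWithin (fun t => toL2 (U t)) (Icc 0 T) 0 = V₀
  equation : ∀ t ∈ Icc 0 T, ∀ V : H2star l,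
    iteratedDerivWithin 2 (fun s => toDual (toL2 (U s))) (Icc 0 T) t V
      + δ * inner ℝ (derivWithin (fun s => toL2 (U s)) (Icc 0 T) t) (toL2 V)
      + form2 σ (U t) V
      + (-P + S * ‖dx (U t)‖ ^ 2) * inner ℝ (dx (U t)) (dx V)
      = inner ℝ (F t) (toL2 V)

theorem form2_add {l : ℝ} (σ : ℝ) (u u' v : H2star l) :
    form2 σ (u + u') v = form2 σ u v + form2 σ u' v := by
  simp only [form2, dxx, dyy, dxy, map_add, inner_add_left]
  ring

theorem form2_smul {l : ℝ} (σ c : ℝ) (u v : H2star l) :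
    form2 σ (c • u) v = c * form2 σ u v := by
  simp only [form2, dxx, dyy, dxy, map_smul, ← smul_add, real_inner_smul_left]
  ring

/-- The space of the solutions `w` in `H²_*`, of the form `w(x, y) = η(y) sin(m x)`, of the buckling
problem `Δ²w + Λ w_xx = 0`, `w = w_xx = 0` on the short edges and
`w_yy + σ w_xx = w_yyy + (2 - σ) w_xxy = 0` on the long edges, in its weak form
`(w, z)_2 = Λ (w_x, z_x)_0` for all `z` in `H²_*`. -/
def eigenspace (l σ : ℝ) (m : ℕ) (Λ : ℝ) : Submodule ℝ (H2star l) where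
  carrier := {w | (∃ η : ℝ → ℝ,
      toL2 w =ᵐ[rectMeasure l] fun p : ℝ × ℝ => η p.2 * Real.sin (m * p.1)) ∧
    ∀ z : H2star l, form2 σ w z = Λ * inner ℝ (dx w) (dx z)}
  zero_mem' := by
    refine ⟨⟨0, ?_⟩, fun z => ?_⟩
    · simp only [toL2, map_zero, Pi.zero_apply, zero_mul]
      exact Lp.coeFn_zero _ _ _
    · simp [form2]
  add_mem' := by
    rintro a b ⟨⟨η, hη⟩, ha⟩ ⟨⟨θ, hθ⟩, hb⟩
    refine ⟨⟨η + θ, ?_⟩, fun z => ?_⟩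
    · simp only [toL2, map_add]
      filter_upwards [Lp.coeFn_add (toL2 a) (toL2 b), hη, hθ] with p h1 h2 h3
      rw [h1, Pi.add_apply, h2, h3, Pi.add_apply, add_mul]
    · rw [form2_add, ha z, hb z]
      simp only [dx, map_add, inner_add_left, mul_add]
  smul_mem' := by
    rintro c a ⟨⟨η, hη⟩, ha⟩
    refine ⟨⟨c • η, ?_⟩, fun z => ?_⟩
    · simp only [toL2, map_smul]
      filter_upwards [Lp.coeFn_smul c (toL2 a), hη] with p h1 h2
      rw [h1, Pi.smul_apply, h2, Pi.smul_apply, smul_eq_mul, smul_eq_mul, mul_assoc]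
    · rw [form2_smul, ha z]
      simp only [dx, map_smul, real_inner_smul_left]
      ring

/-- The eigenvalue `Λ_{m,i}` (`m, i ≥ 1`): the `i`-th eigenvalue, in nondecreasing order and counted
with multiplicity, of the buckling problem among eigenfunctions of the form `η(y) sin(m x)`; that
is, the least `Λ` such that the eigenfunctions with eigenvalue at most `Λ` span a space of dimension
at least `i`. -/
def eigenvalue (l σ : ℝ) (m i : ℕ) : ℝ :=
  sInf {Λ : ℝ | (i : Cardinal) ≤ Module.rank ℝ (⨆ Λ' ∈ Iic Λ, eigenspace l σ m Λ' :
    Submodule ℝ (H2star l))}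

/-- `w` may serve as `w_{m,i}`: it is an eigenfunction of the form `η(y) sin(m x)` of the buckling
problem with eigenvalue `Λ_{m,i}`, normalized in `L²`. -/
def IsEigenfunction {l : ℝ} (σ : ℝ) (m i : ℕ) (w : H2star l) : Prop :=
  w ∈ eigenspace l σ m (eigenvalue l σ m i) ∧ ‖toL2 w‖ = 1

/-- `φ` is the coordinate of an `(m,i)`-simple mode `U(x, y, t) = φ(t) w(x, y)`, `w = w_{m,i}`,
of the plate equation without damping and load, with `U(0) = u₀ w` and `U_t(0) = v₀ w`. -/
structure IsSimpleMode {l : ℝ} (σ P S : ℝ) (m i : ℕ) (w : H2star l) (u₀ v₀ : ℝ)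
    (φ : ℝ → ℝ) : Prop where
  eigenfunction : IsEigenfunction σ m i w
  contDiffOn : ContDiffOn ℝ 2 φ (Ici 0)
  initial : φ 0 = u₀
  initial_velocity : derivWithin φ (Ici 0) 0 = v₀
  solution : ∀ T > 0, IsWeakSolution σ P S 0 T 0 (u₀ • w) (v₀ • toL2 w) (fun t => φ t • w)

/-- The energy `E₀` of the `(m,i)`-simple mode with `φ(0) = u₀`, `φ'(0) = v₀`. -/
def energy (l σ P S : ℝ) (m i : ℕ) (u₀ v₀ : ℝ) : ℝ :=
  v₀ ^ 2 / 2 + m ^ 2 * (eigenvalue l σ m i - P) * (u₀ ^ 2 / 2) + S * ((m ^ 2 * u₀ ^ 2) ^ 2 / 4)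

/-- The coefficient `a(t) = n² (Λ_{n,k} - P) + S m² n² φ(t)²` of the Hill equation. -/
def hillCoeff (l σ P S : ℝ) (m n k : ℕ) (φ : ℝ → ℝ) (t : ℝ) : ℝ :=
  n ^ 2 * (eigenvalue l σ n k - P) + S * m ^ 2 * n ^ 2 * φ t ^ 2

/-- `ξ`, with derivative `ξ'`, solves `ξ'' + a(t) ξ = 0` on `[0, ∞)`. -/
def IsHillSolution (a ξ ξ' : ℝ → ℝ) : Prop :=
  ∀ t ∈ Ici (0 : ℝ), HasDerivWithinAt ξ (ξ' t) (Ici 0) t ∧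
    HasDerivWithinAt ξ' (-(a t * ξ t)) (Ici 0) t

/-- `ξ ≡ 0` is a stable solution of `ξ'' + a(t) ξ = 0`. -/
def HillStable (a : ℝ → ℝ) : Prop :=
  ∀ ε > 0, ∃ δ > 0, ∀ ξ ξ' : ℝ → ℝ, IsHillSolution a ξ ξ' → |ξ 0| + |ξ' 0| < δ →
    ∀ t ≥ 0, |ξ t| + |ξ' t| < ε

/-- All solutions of `ξ'' + a(t) ξ = 0` are bounded. -/
def HillBounded (a : ℝ → ℝ) : Prop :=
  ∀ ξ ξ' : ℝ → ℝ, IsHillSolution a ξ ξ' → ∃ C : ℝ, ∀ t ≥ 0, |ξ t| ≤ C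

/-- A simple mode with coordinate `φ` is `(n,k)` linearly stable. -/
def IsLinearlyStable (l σ P S : ℝ) (m n k : ℕ) (φ : ℝ → ℝ) : Prop :=
  HillStable (hillCoeff l σ P S m n k φ)

/-- `I_j = (j (2j + 1), (j + 1) (2j + 1))`. -/
def intervalI (j : ℕ) : Set ℝ := Ioo (j * (2 * j + 1)) ((j + 1) * (2 * j + 1))

/-- `K_j = ((j + 1) (2j + 1), (j + 1) (2j + 3))`. -/
def intervalK (j : ℕ) : Set ℝ := Ioo ((j + 1) * (2 * j + 1)) ((j + 1) * (2 * j + 3))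

end Plate

end

/-!
A simple mode `U = φ(t) w` is governed by a Duffing equation. The `x`-derivative of
`w = η(y) sin(m x)` is `m η(y) cos(m x)` (`Plate.weakDeriv_profile`), so `‖w_x‖² = m² ‖w‖²`, and
testing the plate equation with `w` gives `φ'' + m² (Λ - P) φ + S m⁴ φ³ = 0`
(`Plate.IsSimpleMode.duffing`). Nothing else about the eigenvalues is needed.

At energy `E` the mode is `φ(t) = A ψ(ω t + t₀)`, where `ψ'' + ε ψ + ψ³ = 0`, `ψ(0) = 1`,
`ψ'(0) = 0`, and the Hill equation becomes `ξ'' + (κ + γ ψ²) ξ = 0` with `γ = n² / m²`; both `ε` and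
`κ` tend to `0` as `E` tends to infinity (`exists_rescaling`). Let `c`, `s` be its even and odd
solutions and `h` a zero of `ψ`. The coefficient is symmetric about `0` and about `h`, hence has
period `2 h`, and its discriminant is `4 X - 2` with `X = c(h) s'(h)`. If `X (1 - X) > 0` a definite
quadratic form is preserved by the translation by `2 h` and all solutions are bounded
(`IsFundamental.exists_bound`); if `X (1 - X) < 0` some solution grows geometrically
(`IsFundamental.exists_unbounded`). The strict sign of `X (1 - X)` persists under small changes of
`ε` and `κ` (`exists_sign_persists`), so everything is decided by the limit equation
`ξ'' + γ ψ² ξ = 0`, `ψ'' + ψ³ = 0`.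

Write `γ = p (p + 1) / 2` with `p ≥ 0`; then `γ ∈ I_j` means `2 j < p < 2 j + 1` and `γ ∈ K_j` means
`2 j + 1 < p < 2 j + 2`. The operator `ξ ↦ (p + 1) ψ' ξ + ψ ξ'` maps solutions for `p` to solutions
for `p + 2` and interchanges even and odd ones, which replaces `X` by `1 - X`
(`IsLinearSolution.raise`, `raise_value`) and leaves `X (1 - X)` unchanged. There remain
`0 < p < 1` and `1 < p < 2`, where the signs of `c(h)`, `s'(h)` and `c'(h)` follow by Sturm
comparison with the explicit solutions `ψ` (for `p = 1`) and `ψ'` (for `p = 2`); this is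
`limit_sign`.
-/

namespace Plate

/-! ### From the plate equation to the Duffing equation -/

theorem rectMeasure_eq_prod (l : ℝ) :
    rectMeasure l = (volume.restrict (Ioo 0 Real.pi)).prod (volume.restrict (Ioo (-l) l)) := by
  rw [rectMeasure, rect, Measure.prod_restrict, Measure.volume_eq_prod]

theorem norm_sq_eq_integral {l : ℝ} (f : L2 l) : ‖f‖ ^ 2 = ∫ p, f p ^ 2 ∂(rectMeasure l) := by
  rw [← real_inner_self_eq_norm_sq, MeasureTheory.L2.inner_def]
  simp [pow_two]

/-- The profile `η` of an `L²` function of the form `η(y) sin(m x)` is square integrable: almost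
every horizontal slice of the function is, and one of these is a nonzero multiple of `η`. -/
theorem memLp_profile {l : ℝ} {m : ℕ} (hm : 1 ≤ m) (f : L2 l) (η : ℝ → ℝ)
    (hf : f =ᵐ[rectMeasure l] fun p : ℝ × ℝ => η p.2 * Real.sin (m * p.1)) :
    MemLp η 2 (volume.restrict (Ioo (-l) l)) := by
  have hg := (Lp.stronglyMeasurable f)
  have hsq : Integrable (fun p => f p ^ 2) (rectMeasure l) := (Lp.memLp f).integrable_sq
  obtain ⟨F, hF⟩ : ∃ F : ℝ × ℝ → ℝ, F = f := ⟨_, rfl⟩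
  rw [← hF] at hg hsq hf
  rw [Filter.EventuallyEq, rectMeasure_eq_prod] at hf
  rw [rectMeasure_eq_prod] at hsq
  have h1 := Measure.ae_ae_of_ae_prod hf
  have h2 := hsq.prod_right_ae
  have h12 := h1.and h2
  rw [ae_restrict_iff' measurableSet_Ioo] at h12
  have hm' : (1 : ℝ) ≤ m := by exact_mod_cast hm
  have hpos : 0 < Real.pi / m := by positivity
  have hle : Real.pi / m ≤ Real.pi := div_le_self Real.pi_pos.le hm'
  have hne : volume (Ioo (0 : ℝ) (Real.pi / m)) ≠ 0 := by
    rw [Real.volume_Ioo]; simp [hpos]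
  obtain ⟨x, hx, hxx⟩ := (frequently_ae_mem_iff.2 hne).and_eventually h12 |>.exists
  obtain ⟨hx1, hx2⟩ := hxx ⟨hx.1, hx.2.trans_le hle⟩
  have hsin : 0 < Real.sin (m * x) := by
    refine Real.sin_pos_of_pos_of_lt_pi (by have := hx.1; positivity) ?_
    have := hx.2
    rw [lt_div_iff₀ (by positivity)] at this
    linarith
  have hmeas : StronglyMeasurable (fun y => F (x, y)) :=
    hg.comp_measurable measurable_prodMk_left
  have hLp : MemLp (fun y => F (x, y)) 2 (volume.restrict (Ioo (-l) l)) :=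
    (memLp_two_iff_integrable_sq hmeas.aestronglyMeasurable).2 hx2
  refine (hLp.const_mul (Real.sin (m * x))⁻¹).ae_eq ?_
  filter_upwards [hx1] with y hy
  rw [hy]
  field_simp

theorem memLp_profile_mul {l : ℝ} {η : ℝ → ℝ} {g : ℝ → ℝ}
    (hη : MemLp η 2 (volume.restrict (Ioo (-l) l))) (hg : Continuous g) :
    MemLp (fun p : ℝ × ℝ => η p.2 * g p.1) 2 (rectMeasure l) := by
  rw [rectMeasure_eq_prod]
  have hm : AEStronglyMeasurable (fun p : ℝ × ℝ => η p.2 * g p.1)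
      ((volume.restrict (Ioo 0 Real.pi)).prod (volume.restrict (Ioo (-l) l))) :=
    (hη.1.comp_snd).mul (hg.comp continuous_fst).aestronglyMeasurable
  rw [memLp_two_iff_integrable_sq hm]
  have h1 : Integrable (fun x => g x ^ 2) (volume.restrict (Ioo 0 Real.pi)) :=
    ((hg.pow 2).continuousOn.integrableOn_Icc (a := 0) (b := Real.pi)).mono_set Ioo_subset_Icc_self
  refine (h1.mul_prod hη.integrable_sq).congr (Filter.Eventually.of_forall fun p => ?_)
  simp only
  ring

theorem integral_sq_profile {l : ℝ} (η g : ℝ → ℝ) :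
    ∫ p : ℝ × ℝ, (η p.2 * g p.1) ^ 2 ∂(rectMeasure l) =
      (∫ x in (0 : ℝ)..Real.pi, g x ^ 2) * ∫ y in Ioo (-l) l, η y ^ 2 := by
  rw [rectMeasure_eq_prod, intervalIntegral.integral_of_le Real.pi_pos.le,
    integral_Ioc_eq_integral_Ioo, ← integral_prod_mul]
  refine integral_congr_ae (Filter.Eventually.of_forall fun p => ?_)
  simp only
  ring

theorem integral_sin_mul_sq {m : ℕ} (hm : 1 ≤ m) :
    ∫ x in (0 : ℝ)..Real.pi, Real.sin (m * x) ^ 2 = Real.pi / 2 := by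
  have hm' : (m : ℝ) ≠ 0 := by positivity
  rw [intervalIntegral.integral_comp_mul_left (fun x => Real.sin x ^ 2) hm', integral_sin_sq]
  simp [Real.sin_nat_mul_pi]
  field_simp

theorem integral_cos_mul_sq {m : ℕ} (hm : 1 ≤ m) :
    ∫ x in (0 : ℝ)..Real.pi, Real.cos (m * x) ^ 2 = Real.pi / 2 := by
  have hm' : (m : ℝ) ≠ 0 := by positivity
  rw [intervalIntegral.integral_comp_mul_left (fun x => Real.cos x ^ 2) hm', integral_cos_sq]
  simp [Real.sin_nat_mul_pi]
  field_simp

/-- The weak `x`-derivative of `η(y) sin(m x)` is `m η(y) cos(m x)`: integrate by parts along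
horizontal lines, where no regularity of `η` is needed, and use that an integrable function is
determined by its integrals against test functions. -/
theorem weakDeriv_profile {l : ℝ} {m : ℕ} (hm : 1 ≤ m) (f g : L2 l) (η : ℝ → ℝ)
    (hf : f =ᵐ[rectMeasure l] fun p : ℝ × ℝ => η p.2 * Real.sin (m * p.1))
    (hfg : IsWeakDeriv l (1, 0) f g) :
    g =ᵐ[rectMeasure l] fun p : ℝ × ℝ => η p.2 * (m * Real.cos (m * p.1)) := by
  have hη := memLp_profile hm f η hf
  have hS := memLp_profile_mul hη (g := fun x => Real.sin (m * x)) (by fun_prop)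
  have hC := memLp_profile_mul hη (g := fun x => m * Real.cos (m * x)) (by fun_prop)
  have hSi := hS.integrable (by norm_num)
  have hCi := hC.integrable (by norm_num)
  have hgi : Integrable g (rectMeasure l) := (Lp.memLp g).integrable (by norm_num)
  have hopen : IsOpen (rect l) := isOpen_Ioo.prod isOpen_Ioo
  have key := hopen.ae_eq_zero_of_integral_contDiff_smul_eq_zero (μ := volume)
    (f := fun p => g p - η p.2 * (m * Real.cos (m * p.1)))
    (IntegrableOn.locallyIntegrableOn (hgi.sub hCi)) ?_
  · refine (ae_restrict_iff' hopen.measurableSet).2 ?_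
    filter_upwards [key] with p hp hpr
    exact sub_eq_zero.1 (hp hpr)
  intro ψ h1 h2 h3
  have hψ : IsTest l ψ := ⟨h1, h2, h3⟩
  have hψ0 : ∀ p ∉ rect l, ψ p = 0 := fun p hp =>
    image_eq_zero_of_notMem_tsupport fun h => hp (h3 h)
  have hψ0' : ∀ p ∉ rect l, fderiv ℝ ψ p (1, 0) = 0 := fun p hp => by
    rw [fderiv_of_notMem_tsupport (𝕜 := ℝ) fun h => hp (h3 h)]; simp
  have hdψ : Continuous fun p => fderiv ℝ ψ p (1, 0) :=
    (h1.continuous_fderiv (by simp)).clm_apply continuous_const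
  have hdψs : HasCompactSupport fun p => fderiv ℝ ψ p (1, 0) := h2.fderiv_apply (𝕜 := ℝ) _
  -- products with continuous functions that vanish off the rectangle are integrable on the plane
  have bdd : ∀ (u k : ℝ × ℝ → ℝ), Integrable u (rectMeasure l) → Continuous k →
      HasCompactSupport k → (∀ p ∉ rect l, k p = 0) → Integrable (fun p => u p * k p) := by
    intro u k hu hk hks hk0
    obtain ⟨C, hCb⟩ := hks.exists_bound_of_continuous hk
    have h := hu.mul_bdd (c := C) hk.aestronglyMeasurable (Filter.Eventually.of_forall hCb)
    refine (integrableOn_iff_integrable_of_support_subset (s := rect l) ?_).1 h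
    intro p hp
    by_contra hn
    exact hp (by simp [hk0 p hn])
  have ibp := integral_bilinear_hasLineDerivAt_right_eq_neg_left_of_integrable
    (μ := (volume : Measure (ℝ × ℝ)))
    (f := fun p : ℝ × ℝ => η p.2 * Real.sin (m * p.1))
    (f' := fun p : ℝ × ℝ => η p.2 * (m * Real.cos (m * p.1)))
    (g := ψ) (g' := fun p => fderiv ℝ ψ p (1, 0)) (v := ((1 : ℝ), (0 : ℝ)))
    (B := ContinuousLinearMap.mul ℝ ℝ)
    (bdd _ _ hCi h1.continuous h2 hψ0) (bdd _ _ hSi hdψ hdψs hψ0')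
    (bdd _ _ hSi h1.continuous h2 hψ0)
    (by
      intro p _
      have h : HasDerivAt (fun t : ℝ => η p.2 * Real.sin (m * (p.1 + t)))
          (η p.2 * (Real.cos (m * (p.1 + 0)) * (m * 1))) 0 := by
        have := ((hasDerivAt_id (0 : ℝ)).const_add p.1).const_mul (m : ℝ)
        exact (this.sin).const_mul _
      unfold HasLineDerivAt
      simpa [mul_comm] using h)
    (by
      intro p _
      exact ((h1.differentiable (by simp)) p).hasFDerivAt.hasLineDerivAt _)
  simp only [ContinuousLinearMap.mul_apply'] at ibp
  have e1 := hfg ψ hψ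
  have e2 : ∫ p, f p * fderiv ℝ ψ p (1, 0) ∂(rectMeasure l)
      = ∫ p : ℝ × ℝ, η p.2 * Real.sin (m * p.1) * fderiv ℝ ψ p (1, 0) := by
    refine (integral_congr_ae ?_).trans (setIntegral_eq_integral_of_forall_compl_eq_zero
      (s := rect l) (fun p hp => by rw [hψ0' p hp, mul_zero]))
    filter_upwards [hf] with p hp
    rw [hp]
  have e3 : ∫ p : ℝ × ℝ, η p.2 * (m * Real.cos (m * p.1)) * ψ p
      = ∫ p : ℝ × ℝ, η p.2 * (m * Real.cos (m * p.1)) * ψ p ∂(rectMeasure l) :=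
    (setIntegral_eq_integral_of_forall_compl_eq_zero (s := rect l)
      (fun p hp => by rw [hψ0 p hp, mul_zero])).symm
  rw [e2, ibp, e3, neg_inj] at e1
  rw [← setIntegral_eq_integral_of_forall_compl_eq_zero (s := rect l)
      (fun p hp => by rw [hψ0 p hp, zero_smul])]
  have hI1 := hψ.integrable_mul g
  have hI2 : Integrable (fun p : ℝ × ℝ => η p.2 * (m * Real.cos (m * p.1)) * ψ p)
      (rectMeasure l) := (bdd _ _ hCi h1.continuous h2 hψ0).integrableOn
  calc ∫ p in rect l, ψ p • (g p - η p.2 * (m * Real.cos (m * p.1)))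
      = ∫ p in rect l, (g p * ψ p - η p.2 * (m * Real.cos (m * p.1)) * ψ p) := by
        refine integral_congr_ae (Filter.Eventually.of_forall fun p => ?_)
        simp only [smul_eq_mul]; ring
    _ = 0 := (integral_sub hI1 hI2).trans (sub_eq_zero.2 (neg_injective (by rw [e1])))

theorem norm_dx_sq {l : ℝ} {m : ℕ} (hm : 1 ≤ m) (w : H2star l) (η : ℝ → ℝ)
    (hw : toL2 w =ᵐ[rectMeasure l] fun p : ℝ × ℝ => η p.2 * Real.sin (m * p.1)) :
    ‖dx w‖ ^ 2 = m ^ 2 * ‖toL2 w‖ ^ 2 := by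
  have hd : IsWeakDeriv l (1, 0) (toL2 w) (dx w) := w.2.1
  have hdx := weakDeriv_profile hm _ _ η hw hd
  rw [norm_sq_eq_integral, norm_sq_eq_integral]
  have e1 : ∫ p, toL2 w p ^ 2 ∂(rectMeasure l)
      = ∫ p : ℝ × ℝ, (η p.2 * Real.sin (m * p.1)) ^ 2 ∂(rectMeasure l) := by
    refine integral_congr_ae ?_
    filter_upwards [hw] with p hp
    rw [hp]
  have e2 : ∫ p, dx w p ^ 2 ∂(rectMeasure l)
      = m ^ 2 * ∫ p : ℝ × ℝ, (η p.2 * Real.cos (m * p.1)) ^ 2 ∂(rectMeasure l) := by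
    rw [← integral_const_mul]
    refine integral_congr_ae ?_
    filter_upwards [hdx] with p hp
    rw [hp]
    ring
  rw [e1, e2, integral_sq_profile η (fun x => Real.sin (m * x)),
    integral_sq_profile η (fun x => Real.cos (m * x)), integral_sin_mul_sq hm,
    integral_cos_mul_sq hm]

/-- The coordinate of a simple mode solves the Duffing equation
`φ'' + m² (Λ_{m,i} - P) φ + S m⁴ φ³ = 0`. -/
theorem IsSimpleMode.duffing {l σ P S : ℝ} {m i : ℕ} (hm : 1 ≤ m) {w : H2star l} {u₀ v₀ : ℝ}
    {φ : ℝ → ℝ} (h : IsSimpleMode σ P S m i w u₀ v₀ φ) :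
    ∃ φ' : ℝ → ℝ, φ 0 = u₀ ∧ φ' 0 = v₀ ∧ ∀ t ∈ Ici (0 : ℝ),
      HasDerivWithinAt φ (φ' t) (Ici 0) t ∧
      HasDerivWithinAt φ' (-(m ^ 2 * (eigenvalue l σ m i - P)) * φ t - S * m ^ 4 * φ t ^ 3)
        (Ici 0) t := by
  obtain ⟨⟨⟨η, hη⟩, hweak⟩, hnorm⟩ := h.eigenfunction
  set Λ := eigenvalue l σ m i with hΛ
  have hdx : ‖dx w‖ ^ 2 = m ^ 2 := by rw [norm_dx_sq hm w η hη, hnorm]; ring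
  have hform : form2 σ w w = Λ * m ^ 2 := by rw [hweak w, real_inner_self_eq_norm_sq, hdx]
  have huniq : UniqueDiffOn ℝ (Ici (0 : ℝ)) := uniqueDiffOn_Ici 0
  refine ⟨derivWithin φ (Ici 0), h.initial, h.initial_velocity, fun t ht => ?_⟩
  have hd1 : DifferentiableOn ℝ φ (Ici 0) := h.contDiffOn.differentiableOn (by norm_num)
  have hd2 : DifferentiableOn ℝ (derivWithin φ (Ici 0)) (Ici 0) :=
    (h.contDiffOn.derivWithin huniq (m := 1) (by norm_num)).differentiableOn (by norm_num)
  refine ⟨(hd1 t ht).hasDerivWithinAt, ?_⟩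
  suffices hs : derivWithin (derivWithin φ (Ici 0)) (Ici 0) t
      = -(m ^ 2 * (Λ - P)) * φ t - S * m ^ 4 * φ t ^ 3 by
    rw [← hs]; exact (hd2 t ht).hasDerivWithinAt
  have ht0 : (0 : ℝ) ≤ t := ht
  have hT : (0 : ℝ) < t + 1 := by linarith
  have htT : t ∈ Icc (0 : ℝ) (t + 1) := ⟨ht, by linarith⟩
  have heq := (h.solution (t + 1) hT).equation t htT w
  have hu2 : UniqueDiffOn ℝ (Icc (0 : ℝ) (t + 1)) := uniqueDiffOn_Icc hT
  have hsub : Icc (0 : ℝ) (t + 1) ⊆ Ici 0 := Icc_subset_Ici_self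
  have hfun : (fun s => toDual (toL2 (φ s • w))) = fun s => φ s • toDual (toL2 w) := by
    funext s
    ext v
    simp [toDual, toL2]
  have hiter : iteratedDerivWithin 2 (fun s => φ s • toDual (toL2 w)) (Icc 0 (t + 1)) t
      = iteratedDerivWithin 2 φ (Icc 0 (t + 1)) t • toDual (toL2 w) :=
    iteratedDerivWithin_smul_const htT hu2 ((h.contDiffOn.mono hsub) t htT) _
  have hmem : ∀ s ∈ Ico (0 : ℝ) (t + 1), Icc (0 : ℝ) (t + 1) =ᶠ[nhds s] Ici (0 : ℝ) := by
    intro s hs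
    filter_upwards [Iio_mem_nhds hs.2] with x hx
    simp only [eq_iff_iff]
    exact ⟨fun hx' => hx'.1, fun hx' => ⟨hx', le_of_lt hx⟩⟩
  have htI : t ∈ Ico (0 : ℝ) (t + 1) := ⟨ht, by linarith⟩
  have hderiv : iteratedDerivWithin 2 φ (Icc 0 (t + 1)) t
      = derivWithin (derivWithin φ (Ici 0)) (Ici 0) t := by
    have h1 : iteratedDerivWithin 2 φ (Icc 0 (t + 1)) t
        = derivWithin (derivWithin φ (Icc 0 (t + 1))) (Icc 0 (t + 1)) t := by
      rw [iteratedDerivWithin_succ, show iteratedDerivWithin 1 φ (Icc 0 (t + 1))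
        = derivWithin φ (Icc 0 (t + 1)) from iteratedDerivWithin_one]
    rw [h1, derivWithin_congr_set (hmem t htI)]
    refine Filter.EventuallyEq.derivWithin_eq ?_ ?_
    · filter_upwards [self_mem_nhdsWithin, mem_nhdsWithin_of_mem_nhds (Iio_mem_nhds htI.2)]
        with s hs1 hs2
      exact derivWithin_congr_set (hmem s ⟨hs1, hs2⟩)
    · exact derivWithin_congr_set (hmem t htI)
  rw [hfun, hiter, hderiv] at heq
  have e1 : toDual (toL2 w) w = 1 := by
    simp only [toDual, ContinuousLinearMap.comp_apply, innerSL_apply_apply]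
    rw [real_inner_self_eq_norm_sq, hnorm]; norm_num
  have e2 : ‖dx (φ t • w)‖ ^ 2 = φ t ^ 2 * m ^ 2 := by
    simp only [dx, map_smul, norm_smul, mul_pow]
    rw [hdx]; simp
  have e3 : inner ℝ (dx (φ t • w)) (dx w) = φ t * m ^ 2 := by
    simp only [dx, map_smul, real_inner_smul_left]
    rw [real_inner_self_eq_norm_sq, hdx]
  rw [e2, e3, form2_smul, hform] at heq
  simp only [smul_apply, e1, smul_eq_mul, zero_mul, mul_one, Pi.zero_apply,
    inner_zero_left, add_zero] at heq
  linear_combination heq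

end Plate

/-! ### Global solutions of ordinary differential equations -/

/-- A bounded vector field which is Lipschitz in space and continuous in time has a global integral
curve through each point. -/
theorem exists_global_integralCurve {E : Type*} [NormedAddCommGroup E] [NormedSpace ℝ E]
    [CompleteSpace E] (v : ℝ → E → E) (K L : NNReal) (hK : ∀ t, LipschitzWith K (v t))
    (hc : ∀ x, Continuous fun t => v t x) (hL : ∀ t x, ‖v t x‖ ≤ L) (z₀ : E) :
    ∃ z : ℝ → E, z 0 = z₀ ∧ ∀ t, HasDerivAt z (v t (z t)) t := by
  have hloc : ∀ T : ℝ, 0 ≤ T → ∃ z : ℝ → E, z 0 = z₀ ∧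
      ∀ t ∈ Ioo (-T) T, HasDerivAt z (v t (z t)) t := by
    intro T hT
    have h0 : (0 : ℝ) ∈ Icc (-T) T := ⟨by linarith, hT⟩
    obtain ⟨T', hT'⟩ : ∃ T' : NNReal, (T' : ℝ) = T := ⟨⟨T, hT⟩, rfl⟩
    have hP : IsPicardLindelof v (⟨0, h0⟩ : Icc (-T) T) z₀ (L * T') 0 L K :=
      { lipschitzOnWith := fun t _ => (hK t).lipschitzOnWith
        continuousOn := fun x _ => (hc x).continuousOn
        norm_le := fun t _ x _ => hL t x
        mul_max_le := by simp [hT'] }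
    obtain ⟨z, hz0, hz⟩ := hP.exists_eq_forall_mem_Icc_hasDerivWithinAt₀
    exact ⟨z, hz0, fun t ht =>
      (hz t (Ioo_subset_Icc_self ht)).hasDerivAt (Icc_mem_nhds ht.1 ht.2)⟩
  choose! Z hZ0 hZ using hloc
  have hcompat : ∀ T T' : ℝ, 0 < T → T ≤ T' → EqOn (Z T) (Z T') (Ioo (-T) T) := by
    intro T T' hT hTT'
    refine ODE_solution_unique_of_mem_Ioo (s := fun _ => univ) (v := v) (K := K)
      (fun t _ => (hK t).lipschitzOnWith) (t₀ := 0) ⟨by linarith, hT⟩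
      (fun t ht => ⟨hZ T hT.le t ht, mem_univ _⟩)
      (fun t ht => ⟨hZ T' (hT.le.trans hTT') t ⟨by linarith [ht.1], by linarith [ht.2]⟩,
        mem_univ _⟩) ?_
    rw [hZ0 T hT.le, hZ0 T' (hT.le.trans hTT')]
  refine ⟨fun t => Z (|t| + 1) t, by simp only [abs_zero]; exact hZ0 _ (by norm_num),
    fun t => ?_⟩
  have hself : ∀ s : ℝ, s ∈ Ioo (-(|s| + 1)) (|s| + 1) := fun s =>
    ⟨by linarith [neg_abs_le s], by linarith [le_abs_self s]⟩
  have hnear : (fun s => Z (|s| + 1) s) =ᶠ[nhds t] Z (|t| + 2) := by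
    have : ∀ᶠ s in nhds t, |s| < |t| + 1 :=
      (continuous_abs.tendsto t).eventually_lt_const (by linarith)
    filter_upwards [this] with s hs
    exact hcompat _ _ (by positivity) (by linarith) (hself s)
  have hval : Z (|t| + 1) t = Z (|t| + 2) t :=
    hcompat _ _ (by positivity) (by linarith) (hself t)
  simp only [hval]
  refine HasDerivAt.congr_of_eventuallyEq ?_ hnear
  exact hZ _ (by positivity) t ⟨by linarith [(hself t).1], by linarith [(hself t).2]⟩

/-- A pair `(u, u')` solving `u'' + q(t) u = 0` on the whole line. -/
def IsLinearSolution (q u u' : ℝ → ℝ) : Prop :=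
  ∀ t, HasDerivAt u (u' t) t ∧ HasDerivAt u' (-(q t * u t)) t

/-- The initial value problem for `u'' + q u = 0` with bounded continuous `q`, solved in polar
coordinates `u = r cos θ`, `u' = r sin θ`: the equation for `θ` is bounded and Lipschitz. -/
theorem exists_linearSolution_polar {q : ℝ → ℝ} (hq : Continuous q) {B : ℝ}
    (hB : ∀ t, |q t| ≤ B) (θ₀ : ℝ) :
    ∃ u u' : ℝ → ℝ, IsLinearSolution q u u' ∧ u 0 = Real.cos θ₀ ∧ u' 0 = Real.sin θ₀ := by
  have hB0 : 0 ≤ B := (abs_nonneg _).trans (hB 0)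
  have h1q : ∀ t, |1 - q t| ≤ 1 + B := fun t => by
    have := hB t
    rw [abs_le] at this ⊢
    constructor <;> linarith [this.1, this.2]
  obtain ⟨K, hK⟩ : ∃ K : NNReal, (K : ℝ) = 2 * (1 + B) := ⟨⟨_, by positivity⟩, rfl⟩
  obtain ⟨L, hL⟩ : ∃ L : NNReal, (L : ℝ) = 1 + 2 * B := ⟨⟨_, by positivity⟩, rfl⟩
  obtain ⟨θ, hθ0, hθ⟩ := exists_global_integralCurve
    (fun t θ => -(q t + (1 - q t) * Real.sin θ ^ 2)) K L
    (by
      intro t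
      refine LipschitzWith.of_dist_le_mul fun a b => ?_
      rw [Real.dist_eq, Real.dist_eq, hK]
      have e : -(q t + (1 - q t) * Real.sin a ^ 2) - -(q t + (1 - q t) * Real.sin b ^ 2)
          = -(1 - q t) * ((Real.sin a + Real.sin b) * (Real.sin a - Real.sin b)) := by ring
      rw [e, abs_mul, abs_mul, abs_neg]
      have h1 : |Real.sin a + Real.sin b| ≤ 2 :=
        (abs_add_le _ _).trans (by linarith [Real.abs_sin_le_one a, Real.abs_sin_le_one b])
      have h2 : |Real.sin a - Real.sin b| ≤ |a - b| := by
        simpa [Real.dist_eq] using Real.lipschitzWith_sin.dist_le_mul a b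
      calc |1 - q t| * (|Real.sin a + Real.sin b| * |Real.sin a - Real.sin b|)
          ≤ (1 + B) * (2 * |a - b|) := by gcongr; exact h1q t
        _ = 2 * (1 + B) * |a - b| := by ring)
    (fun x => by fun_prop)
    (by
      intro t x
      rw [Real.norm_eq_abs, hL, abs_neg]
      have h1 := Real.sin_sq_le_one x
      have h2 := sq_nonneg (Real.sin x)
      have h3 := abs_le.1 (hB t)
      rw [abs_le]
      constructor <;> nlinarith [h3.1, h3.2])
    θ₀
  have hθc : Continuous θ := continuous_iff_continuousAt.2 fun t => (hθ t).continuousAt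
  set g : ℝ → ℝ := fun t => (1 - q t) * Real.sin (θ t) * Real.cos (θ t) with hg
  have hgc : Continuous g := by fun_prop
  set r : ℝ → ℝ := fun t => Real.exp (∫ s in (0 : ℝ)..t, g s) with hr
  have hrd : ∀ t, HasDerivAt r (r t * g t) t := fun t =>
    (intervalIntegral.integral_hasDerivAt_right (hgc.intervalIntegrable _ _)
      (hgc.stronglyMeasurableAtFilter _ _) hgc.continuousAt).exp
  refine ⟨fun t => r t * Real.cos (θ t), fun t => r t * Real.sin (θ t), fun t => ⟨?_, ?_⟩,
    by simp [hr, hθ0], by simp [hr, hθ0]⟩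
  · refine ((hrd t).mul (hθ t).cos).congr_deriv ?_
    simp only [hg]
    linear_combination (r t * Real.sin (θ t)) * (1 - q t) * Real.sin_sq_add_cos_sq (θ t)
  · refine ((hrd t).mul (hθ t).sin).congr_deriv ?_
    simp only [hg]
    ring

/-! ### The Duffing equation -/

/-- The first zero of a continuous function which is positive at `a` and not at `b`. -/
theorem exists_first_zero {f : ℝ → ℝ} (hf : Continuous f) {a b : ℝ} (hab : a ≤ b) (ha : 0 < f a)
    (hb : f b ≤ 0) : ∃ t ∈ Ioc a b, f t = 0 ∧ ∀ x ∈ Ico a t, 0 < f x := by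
  have hne : (Icc a b ∩ f ⁻¹' {0}).Nonempty := by
    obtain ⟨t, ht, h0⟩ := intermediate_value_Icc' hab hf.continuousOn ⟨hb, ha.le⟩
    exact ⟨t, ht, h0⟩
  obtain ⟨t, ⟨ht, ht0⟩, hmin⟩ := (isCompact_Icc.inter_right
    (isClosed_singleton.preimage hf)).exists_isLeast hne
  have hta : a ≠ t := by rintro rfl; exact ha.ne' ht0
  refine ⟨t, ⟨lt_of_le_of_ne ht.1 hta, ht.2⟩, ht0, fun x hx => ?_⟩
  by_contra! hneg
  obtain ⟨y, hy, hy0⟩ := intermediate_value_Icc' hx.1 hf.continuousOn ⟨hneg, ha.le⟩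
  have := hmin ⟨⟨hy.1, hy.2.trans (hx.2.le.trans ht.2)⟩, hy0⟩
  linarith [hy.2, hx.2]

/-- A function on an interval `[a, b]` with zero derivative takes equal values at the ends. -/
theorem eq_of_hasDerivAt_zero {f f' : ℝ → ℝ} {a b : ℝ} (hab : a ≤ b)
    (hf : ∀ t ∈ Icc a b, HasDerivAt f (f' t) t) (h0 : ∀ t ∈ Icc a b, f' t = 0) : f b = f a :=
  constant_of_has_deriv_right_zero (fun t ht => (hf t ht).continuousAt.continuousWithinAt)
    (fun t ht => by
      have := (hf t (Ico_subset_Icc_self ht)).hasDerivWithinAt (s := Ici t)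
      rwa [h0 t (Ico_subset_Icc_self ht)] at this) b ⟨hab, le_rfl⟩

/-- A pair `(ψ, ψ')` solving the Duffing equation `ψ'' + ε ψ + ψ³ = 0` on the whole line, at rest
at `ψ = 1` at time `0`. -/
structure IsDuffing (ε : ℝ) (ψ ψ' : ℝ → ℝ) : Prop where
  deriv : ∀ t, HasDerivAt ψ (ψ' t) t
  deriv' : ∀ t, HasDerivAt ψ' (-(ε * ψ t) - ψ t ^ 3) t
  init : ψ 0 = 1
  init' : ψ' 0 = 0

/-- Truncation of a real number to `[-2, 2]`. -/
noncomputable def clampTwo (x : ℝ) : ℝ := max (-2) (min x 2)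

theorem abs_clampTwo_le (x : ℝ) : |clampTwo x| ≤ 2 := by
  rw [abs_le, clampTwo]
  exact ⟨le_max_left _ _, max_le (by norm_num) (min_le_right _ _)⟩

theorem clampTwo_of_abs_le {x : ℝ} (hx : |x| ≤ 2) : clampTwo x = x := by
  rw [abs_le] at hx
  rw [clampTwo, min_eq_left hx.2, max_eq_right hx.1]

theorem clampTwo_neg (x : ℝ) : clampTwo (-x) = -clampTwo x := by
  unfold clampTwo
  rcases le_total x 2 with h | h <;> rcases le_total (-x) 2 with h' | h' <;>
  simp [h, h'] <;> grind

theorem lipschitzWith_clampTwo : LipschitzWith 1 clampTwo :=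
  (LipschitzWith.id.min_const 2).const_max (-2)

theorem abs_clampTwo_sub_le (x y : ℝ) : |clampTwo x - clampTwo y| ≤ |x - y| := by
  simpa [Real.dist_eq] using lipschitzWith_clampTwo.dist_le_mul x y

/-- A solution of the truncated Duffing system never reaches the truncation, because as long as it
does not its energy is conserved. -/
theorem norm_lt_two_of_truncated {ε : ℝ} (hε0 : 0 ≤ ε) (hε : ε ≤ 1) {z : ℝ → ℝ × ℝ}
    (h0 : z 0 = (1, 0))
    (hz : ∀ t, HasDerivAt z (clampTwo (z t).2, -(ε * clampTwo (z t).1) - clampTwo (z t).1 ^ 3) t)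
    {t : ℝ} (ht : 0 ≤ t) : ‖z t‖ < 2 := by
  by_contra! hge
  have hzc : Continuous z := continuous_iff_continuousAt.2 fun t => (hz t).continuousAt
  obtain ⟨b, hb, hb0, hpos⟩ := exists_first_zero (f := fun t => 2 - ‖z t‖) (by fun_prop) ht
    (by simp [h0, Prod.norm_def]) (by linarith)
  have hle : ∀ s ∈ Icc 0 b, ‖z s‖ ≤ 2 := by
    intro s hs
    rcases hs.2.lt_or_eq with h | h
    · linarith [hpos s ⟨hs.1, h⟩]
    · rw [h]; linarith
  have hx : ∀ s, HasDerivAt (fun t => (z t).1) (clampTwo (z s).2) s := fun s => (hz s).fst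
  have hv : ∀ s, HasDerivAt (fun t => (z t).2)
      (-(ε * clampTwo (z s).1) - clampTwo (z s).1 ^ 3) s := fun s => (hz s).snd
  have hE := eq_of_hasDerivAt_zero hb.1.le
    (f := fun t => (z t).2 ^ 2 + ε * (z t).1 ^ 2 + (z t).1 ^ 4 / 2)
    (fun s _ => (((hv s).pow 2).add (((hx s).pow 2).const_mul ε)).add
      (((hx s).pow 4).div_const 2)) (by
      intro s hs
      have hs2 := hle s hs
      rw [Prod.norm_def, max_le_iff] at hs2
      rw [clampTwo_of_abs_le hs2.1, clampTwo_of_abs_le hs2.2]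
      push_cast
      ring)
  have h2 : ‖z b‖ = 2 := by linarith
  simp only [h0] at hE
  rw [Prod.norm_def] at h2
  have hq := sq_nonneg (z b).1
  have hq4 : 0 ≤ (z b).1 ^ 4 := by positivity
  rcases max_choice ‖(z b).1‖ ‖(z b).2‖ with h | h
  · rw [h, Real.norm_eq_abs] at h2
    have : (z b).1 ^ 2 = 4 := by rw [← sq_abs, h2]; norm_num
    have h4 : (z b).1 ^ 4 = 16 := by
      rw [show (z b).1 ^ 4 = ((z b).1 ^ 2) ^ 2 by ring, this]; norm_num
    nlinarith [sq_nonneg (z b).2]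
  · rw [h, Real.norm_eq_abs] at h2
    have : (z b).2 ^ 2 = 4 := by rw [← sq_abs, h2]; norm_num
    nlinarith

theorem exists_isDuffing {ε : ℝ} (hε0 : 0 ≤ ε) (hε : ε ≤ 1) : ∃ ψ ψ' : ℝ → ℝ, IsDuffing ε ψ ψ' := by
  -- for `ε ≤ 1` the truncated field is Lipschitz with constant `1 + 3 · 2²` and bounded by
  -- `2 (1 + 2²)`
  obtain ⟨z, h0, hz⟩ := exists_global_integralCurve
    (fun _ (z : ℝ × ℝ) => (clampTwo z.2, -(ε * clampTwo z.1) - clampTwo z.1 ^ 3)) 13 10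
    (by
      intro _
      refine LipschitzWith.of_dist_le_mul fun a b => ?_
      have h1 : |a.1 - b.1| ≤ dist a b := le_max_left (dist a.1 b.1) _
      have h2 : |a.2 - b.2| ≤ dist a b := le_max_right (dist a.1 b.1) (dist a.2 b.2)
      have c1 := abs_clampTwo_sub_le a.1 b.1
      have c2 := abs_clampTwo_sub_le a.2 b.2
      have hd : 0 ≤ dist a b := dist_nonneg
      have e13 : ((13 : NNReal) : ℝ) = 13 := rfl
      rw [Prod.dist_eq, Real.dist_eq, Real.dist_eq, e13]
      refine max_le (by simp only; linarith) ?_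
      simp only
      set x := clampTwo a.1
      set y := clampTwo b.1
      have e : -(ε * x) - x ^ 3 - (-(ε * y) - y ^ 3)
          = -((ε + (x ^ 2 + x * y + y ^ 2)) * (x - y)) := by ring
      have hx := abs_le.1 (abs_clampTwo_le a.1)
      have hy := abs_le.1 (abs_clampTwo_le b.1)
      have hb : |ε + (x ^ 2 + x * y + y ^ 2)| ≤ 13 := by
        rw [abs_le]
        constructor <;>
        nlinarith [sq_nonneg (x + y), sq_nonneg x, sq_nonneg y, hx.1, hx.2, hy.1, hy.2]
      rw [e, abs_neg, abs_mul]
      exact mul_le_mul hb (c1.trans h1) (abs_nonneg _) (by norm_num))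
    (fun _ => continuous_const)
    (by
      intro _ z
      have hx := abs_le.1 (abs_clampTwo_le z.1)
      have hy := abs_clampTwo_le z.2
      have e10 : ((10 : NNReal) : ℝ) = 10 := rfl
      rw [Prod.norm_def, e10]
      refine max_le (by simp only [Real.norm_eq_abs]; linarith) ?_
      simp only [Real.norm_eq_abs]
      set x := clampTwo z.1
      rw [show -(ε * x) - x ^ 3 = -((ε + x ^ 2) * x) by ring, abs_neg, abs_mul]
      have h5 : |ε + x ^ 2| ≤ 5 := by
        rw [abs_le]; constructor <;> nlinarith [hx.1, hx.2]
      calc |ε + x ^ 2| * |x| ≤ 5 * 2 := mul_le_mul h5 (abs_clampTwo_le _) (abs_nonneg _) (by norm_num)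
        _ = 10 := by norm_num)
    ((1 : ℝ), (0 : ℝ))
  have hlt : ∀ t, ‖z t‖ ≤ 2 := by
    intro t
    rcases le_total 0 t with ht | ht
    · exact (norm_lt_two_of_truncated hε0 hε h0 hz ht).le
    · -- the time reversed curve solves the same system
      have := norm_lt_two_of_truncated hε0 hε (z := fun t => ((z (-t)).1, -(z (-t)).2))
        (by simp [h0]) (fun s => by
          have h1 : HasDerivAt (fun t => (z t).1) (clampTwo (z (-s)).2) (-s) := (hz (-s)).fst
          have h2 : HasDerivAt (fun t => (z t).2)
            (-(ε * clampTwo (z (-s)).1) - clampTwo (z (-s)).1 ^ 3) (-s) := (hz (-s)).snd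
          refine ((h1.scomp s (hasDerivAt_neg s)).prodMk
            (h2.scomp s (hasDerivAt_neg s)).neg).congr_deriv ?_
          simp [clampTwo_neg, sub_eq_add_neg]) (t := -t) (by linarith)
      simp only [neg_neg] at this
      simpa [Prod.norm_def] using this.le
  have hc : ∀ t, clampTwo (z t).1 = (z t).1 ∧ clampTwo (z t).2 = (z t).2 := by
    intro t
    have := hlt t
    rw [Prod.norm_def, max_le_iff] at this
    exact ⟨clampTwo_of_abs_le this.1, clampTwo_of_abs_le this.2⟩
  refine ⟨fun t => (z t).1, fun t => (z t).2, fun t => ?_, fun t => ?_, by simp [h0], by simp [h0]⟩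
  · have : HasDerivAt (fun t => (z t).1) (clampTwo (z t).2) t := (hz t).fst
    simpa only [(hc t).2] using this
  · have : HasDerivAt (fun t => (z t).2)
      (-(ε * clampTwo (z t).1) - clampTwo (z t).1 ^ 3) t := (hz t).snd
    simpa only [(hc t).1] using this

namespace IsDuffing

variable {ε : ℝ} {ψ ψ' : ℝ → ℝ}

theorem continuous (h : IsDuffing ε ψ ψ') : Continuous ψ :=
  continuous_iff_continuousAt.2 fun t => (h.deriv t).continuousAt

theorem continuous' (h : IsDuffing ε ψ ψ') : Continuous ψ' :=
  continuous_iff_continuousAt.2 fun t => (h.deriv' t).continuousAt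

theorem energy_eq (h : IsDuffing ε ψ ψ') (t : ℝ) :
    ψ' t ^ 2 + ε * ψ t ^ 2 + ψ t ^ 4 / 2 = ε + 1 / 2 := by
  have hd : ∀ s, HasDerivAt (fun t => ψ' t ^ 2 + ε * ψ t ^ 2 + ψ t ^ 4 / 2) 0 s := fun s => by
    refine ((((h.deriv' s).pow 2).add (((h.deriv s).pow 2).const_mul ε)).add
      (((h.deriv s).pow 4).div_const 2)).congr_deriv ?_
    push_cast
    ring
  have := is_const_of_deriv_eq_zero (fun s => (hd s).differentiableAt) (fun s => (hd s).deriv) t 0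
  simp only [h.init, h.init'] at this
  linarith

theorem abs_le_one (h : IsDuffing ε ψ ψ') (hε : 0 ≤ ε) (t : ℝ) : |ψ t| ≤ 1 := by
  have := h.energy_eq t
  rw [← sq_le_one_iff_abs_le_one]
  by_contra! hgt
  nlinarith [sq_nonneg (ψ' t), mul_nonneg hε (sub_nonneg.2 hgt.le)]

end IsDuffing

/-! ### Grönwall estimates for second order equations -/

theorem abs_le_gronwallBound {d d' d'' : ℝ → ℝ} {K δ η T : ℝ} (hK : 1 ≤ K) (hη : 0 ≤ η)
    (hd : ∀ t ∈ Ici (0 : ℝ), HasDerivWithinAt d (d' t) (Ici 0) t)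
    (hd' : ∀ t ∈ Ici (0 : ℝ), HasDerivWithinAt d' (d'' t) (Ici 0) t)
    (h : ∀ t ∈ Ico 0 T, |d'' t| ≤ K * |d t| + η) (h0 : |d 0| ≤ δ) (h0' : |d' 0| ≤ δ) :
    ∀ t ∈ Icc 0 T, |d t| ≤ gronwallBound δ K η t ∧ |d' t| ≤ gronwallBound δ K η t := by
  intro t ht
  have hz : ∀ s ∈ Ici (0 : ℝ), HasDerivWithinAt (fun s => (d s, d' s)) (d' s, d'' s) (Ici 0) s :=
    fun s hs => (hd s hs).prodMk (hd' s hs)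
  have key := norm_le_gronwallBound_of_norm_deriv_right_le (f := fun s => (d s, d' s))
    (f' := fun s => (d' s, d'' s)) (δ := δ) (K := K) (ε := η) (a := 0) (b := T)
    (fun s hs => ((hz s hs.1).continuousWithinAt).mono Icc_subset_Ici_self)
    (fun s hs => (hz s hs.1).mono (Ici_subset_Ici.2 hs.1))
    (by rw [Prod.norm_def]; exact max_le h0 h0')
    (by
      intro s hs
      have h1 : |d s| ≤ ‖(d s, d' s)‖ := le_max_left _ _
      have h2 : |d' s| ≤ ‖(d s, d' s)‖ := le_max_right (|d s|) _
      have h3 : 0 ≤ ‖(d s, d' s)‖ := norm_nonneg _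
      have h4 := h s hs
      refine (max_le (a := ‖d' s‖) (b := ‖d'' s‖) ?_ ?_)
      · rw [Real.norm_eq_abs]; nlinarith
      · rw [Real.norm_eq_abs]; nlinarith) t ht
  rw [sub_zero] at key
  exact ⟨(le_max_left |d t| |d' t|).trans key, (le_max_right |d t| |d' t|).trans key⟩

/-! ### Wronskians and fundamental systems -/

namespace IsLinearSolution

variable {q u u' v v' : ℝ → ℝ}

theorem isHillSolution (h : IsLinearSolution q u u') : Plate.IsHillSolution q u u' :=
  fun t _ => ⟨(h t).1.hasDerivWithinAt, (h t).2.hasDerivWithinAt⟩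

theorem continuous (h : IsLinearSolution q u u') : Continuous u :=
  continuous_iff_continuousAt.2 fun t => (h t).1.continuousAt

theorem continuous' (h : IsLinearSolution q u u') : Continuous u' :=
  continuous_iff_continuousAt.2 fun t => (h t).2.continuousAt

theorem congr {q' : ℝ → ℝ} (h : IsLinearSolution q u u') (hq : ∀ t, q' t = q t) :
    IsLinearSolution q' u u' := by
  rwa [show q' = q from funext hq]

theorem combination (hu : IsLinearSolution q u u') (hv : IsLinearSolution q v v') (a b : ℝ) :
    IsLinearSolution q (fun t => a * u t + b * v t) (fun t => a * u' t + b * v' t) := fun t =>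
  ⟨((hu t).1.const_mul a).add ((hv t).1.const_mul b),
    (((hu t).2.const_mul a).add ((hv t).2.const_mul b)).congr_deriv (by ring)⟩

/-- The affine change of time `t ↦ ω t + b`. -/
theorem comp_affine (h : IsLinearSolution q u u') (ω b : ℝ) :
    IsLinearSolution (fun t => ω ^ 2 * q (ω * t + b)) (fun t => u (ω * t + b))
      (fun t => ω * u' (ω * t + b)) := by
  intro t
  have hd : HasDerivAt (fun t => ω * t + b) ω t := by
    simpa using ((hasDerivAt_id t).const_mul ω).add_const b
  exact ⟨(((h (ω * t + b)).1).comp t hd).congr_deriv (by ring),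
    ((((h (ω * t + b)).2).comp t hd).const_mul ω).congr_deriv (by ring)⟩

theorem wronskian_hasDerivAt {r : ℝ → ℝ} (hu : IsLinearSolution q u u')
    (hv : IsLinearSolution r v v') (t : ℝ) :
    HasDerivAt (fun t => u t * v' t - u' t * v t) ((q t - r t) * (u t * v t)) t :=
  (((hu t).1.mul (hv t).2).sub ((hu t).2.mul (hv t).1)).congr_deriv (by ring)

theorem wronskian_eq (hu : IsLinearSolution q u u') (hv : IsLinearSolution q v v') (t : ℝ) :
    u t * v' t - u' t * v t = u 0 * v' 0 - u' 0 * v 0 := by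
  have hd : ∀ s, HasDerivAt (fun t => u t * v' t - u' t * v t) 0 s := fun s =>
    (hu.wronskian_hasDerivAt hv s).congr_deriv (by ring)
  exact is_const_of_deriv_eq_zero (fun s => (hd s).differentiableAt) (fun s => (hd s).deriv) t 0

end IsLinearSolution

theorem Plate.IsHillSolution.wronskian_eq {q u u' v v' : ℝ → ℝ} (hu : Plate.IsHillSolution q u u')
    (hv : Plate.IsHillSolution q v v') {t : ℝ} (ht : 0 ≤ t) :
    u t * v' t - u' t * v t = u 0 * v' 0 - u' 0 * v 0 := by
  have hd : ∀ s ∈ Ici (0 : ℝ), HasDerivWithinAt (fun t => u t * v' t - u' t * v t) 0 (Ici 0) s :=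
    fun s hs => (((hu s hs).1.mul (hv s hs).2).sub ((hu s hs).2.mul (hv s hs).1)).congr_deriv
      (by ring)
  exact constant_of_has_deriv_right_zero (a := 0) (b := t)
    (fun s hs => (hd s hs.1).continuousWithinAt.mono Icc_subset_Ici_self)
    (fun s hs => (hd s hs.1).mono (Ici_subset_Ici.2 hs.1)) t ⟨ht, le_rfl⟩

/-- The solutions `c`, `s` of `u'' + q u = 0` with `c = 1`, `c' = 0` and `s = 0`, `s' = 1` at
time `0`. -/
structure IsFundamental (q c c' s s' : ℝ → ℝ) : Prop where
  cosine : IsLinearSolution q c c'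
  sine : IsLinearSolution q s s'
  c_zero : c 0 = 1
  c'_zero : c' 0 = 0
  s_zero : s 0 = 0
  s'_zero : s' 0 = 1

theorem exists_isFundamental {q : ℝ → ℝ} (hq : Continuous q) {B : ℝ} (hB : ∀ t, |q t| ≤ B) :
    ∃ c c' s s' : ℝ → ℝ, IsFundamental q c c' s s' := by
  obtain ⟨c, c', hc, h1, h2⟩ := exists_linearSolution_polar hq hB 0
  obtain ⟨s, s', hs, h3, h4⟩ := exists_linearSolution_polar hq hB (Real.pi / 2)
  exact ⟨c, c', s, s', hc, hs, by simpa using h1, by simpa using h2, by simpa using h3,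
    by simpa using h4⟩

namespace IsFundamental

variable {q c c' s s' : ℝ → ℝ}

theorem wronskian (h : IsFundamental q c c' s s') (t : ℝ) : c t * s' t - c' t * s t = 1 := by
  rw [h.cosine.wronskian_eq h.sine, h.c_zero, h.c'_zero, h.s'_zero]; ring

theorem eq_combination (h : IsFundamental q c c' s s') {u u' : ℝ → ℝ}
    (hu : IsLinearSolution q u u') (t : ℝ) :
    u t = u 0 * c t + u' 0 * s t ∧ u' t = u 0 * c' t + u' 0 * s' t := by
  have h1 := hu.wronskian_eq h.sine t
  have h2 := h.cosine.wronskian_eq hu t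
  have h3 := h.wronskian t
  rw [h.s_zero, h.s'_zero] at h1
  rw [h.c_zero, h.c'_zero] at h2
  constructor
  · linear_combination c t * h1 + s t * h2 - u t * h3
  · linear_combination c' t * h1 + s' t * h2 - u' t * h3

variable {h : ℝ}

theorem even_odd (hf : IsFundamental q c c' s s') (hq0 : ∀ t, q (-t) = q t) (t : ℝ) :
    c (-t) = c t ∧ c' (-t) = -c' t ∧ s (-t) = -s t ∧ s' (-t) = s' t := by
  have hc := (hf.cosine.comp_affine (-1) 0).congr (q' := q) (fun t => by simp [hq0])
  have hs := (hf.sine.comp_affine (-1) 0).congr (q' := q) (fun t => by simp [hq0])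
  have e1 := hf.eq_combination hc t
  have e2 := hf.eq_combination hs t
  simp only [mul_zero, add_zero, hf.c_zero, hf.c'_zero, hf.s_zero, hf.s'_zero, neg_mul, one_mul,
    zero_mul, zero_add] at e1 e2
  exact ⟨e1.1, by linarith [e1.2], e2.1, by linarith [e2.2]⟩

/-- If `q` is symmetric about `0` and about `h`, the values at the end of the period `2 h` are
determined by those at `h`, by reflection in `h`. -/
theorem values_two_mul (hf : IsFundamental q c c' s s') (hqh : ∀ t, q (2 * h - t) = q t) :
    c (2 * h) = 2 * (c h * s' h) - 1 ∧ s' (2 * h) = 2 * (c h * s' h) - 1 ∧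
      c' (2 * h) = 2 * (c h * c' h) ∧ s (2 * h) = 2 * (s h * s' h) := by
  have hc := (hf.cosine.comp_affine (-1) (2 * h)).congr (q' := q)
    (fun t => by rw [show -1 * t + 2 * h = 2 * h - t by ring, hqh]; ring)
  have hs := (hf.sine.comp_affine (-1) (2 * h)).congr (q' := q)
    (fun t => by rw [show -1 * t + 2 * h = 2 * h - t by ring, hqh]; ring)
  have e1 := hf.eq_combination hc h
  have e2 := hf.eq_combination hs h
  rw [show -1 * h + 2 * h = h by ring, show (-1 : ℝ) * 0 + 2 * h = 2 * h by ring] at e1 e2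
  have w := hf.wronskian h
  obtain ⟨e1, e1'⟩ := e1
  obtain ⟨e2, e2'⟩ := e2
  refine ⟨?_, ?_, ?_, ?_⟩
  · linear_combination -s' h * e1 + s h * e1' - (c (2 * h) + 1) * w
  · linear_combination -c' h * e2 + c h * e2' - (s' (2 * h) + 1) * w
  · linear_combination -c' h * e1 + c h * e1' - c' (2 * h) * w
  · linear_combination -s' h * e2 + s h * e2' - s (2 * h) * w

theorem translate (hf : IsFundamental q c c' s s') (hq0 : ∀ t, q (-t) = q t)
    (hqh : ∀ t, q (2 * h - t) = q t) (a b t : ℝ) :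
    a * c (t + 2 * h) + b * s (t + 2 * h) =
        ((2 * (c h * s' h) - 1) * a + 2 * (s h * s' h) * b) * c t +
        (2 * (c h * c' h) * a + (2 * (c h * s' h) - 1) * b) * s t ∧
      a * c' (t + 2 * h) + b * s' (t + 2 * h) =
        ((2 * (c h * s' h) - 1) * a + 2 * (s h * s' h) * b) * c' t +
        (2 * (c h * c' h) * a + (2 * (c h * s' h) - 1) * b) * s' t := by
  have hper : ∀ t, q (t + 2 * h) = q t := fun t => by
    rw [← hqh (t + 2 * h), show 2 * h - (t + 2 * h) = -t by ring, hq0]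
  have hu := ((hf.cosine.combination hf.sine a b).comp_affine 1 (2 * h)).congr (q' := q)
    (fun t => by rw [one_mul, hper]; ring)
  have e := hf.eq_combination hu t
  simp only [one_mul, zero_add] at e
  obtain ⟨h1, h2, h3, h4⟩ := hf.values_two_mul hqh
  rw [h1, h2, h3, h4] at e
  constructor
  · linear_combination e.1
  · linear_combination e.2

/-! ### Floquet theory of a symmetric Hill equation -/

/-- The quadratic form `c c'(h) a² - s s'(h) b²` in the coordinates of a solution `a c + b s` is
invariant under translation by the period `2 h`; when `0 < c(h) s'(h) < 1` it is definite. -/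
theorem exists_bound (hf : IsFundamental q c c' s s') (hq0 : ∀ t, q (-t) = q t)
    (hqh : ∀ t, q (2 * h - t) = q t) (hh : 0 < h)
    (hX : 0 < (c h * s' h) * (1 - c h * s' h)) :
    ∃ B, ∀ t, |c t| ≤ B ∧ |c' t| ≤ B ∧ |s t| ≤ B ∧ |s' t| ≤ B := by
  have w := hf.wronskian h
  have hPR : (c h * c' h) * (s h * s' h) < 0 := by
    have : (c h * c' h) * (s h * s' h) = -((c h * s' h) * (1 - c h * s' h)) := by
      linear_combination (-(c h * s' h)) * w
    linarith
  set P := c h * c' h with hP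
  set R := s h * s' h with hR
  have hP0 : P ≠ 0 := by rintro h0; rw [h0, zero_mul] at hPR; exact lt_irrefl _ hPR
  obtain ⟨K, hK0, hK⟩ : ∃ K, 0 ≤ K ∧ ∀ t ∈ Icc 0 (2 * h),
      |c t| ≤ K ∧ |c' t| ≤ K ∧ |s t| ≤ K ∧ |s' t| ≤ K := by
    obtain ⟨K1, h1⟩ := isCompact_Icc.exists_bound_of_continuousOn (s := Icc 0 (2 * h))
      hf.cosine.continuous.continuousOn
    obtain ⟨K2, h2⟩ := isCompact_Icc.exists_bound_of_continuousOn (s := Icc 0 (2 * h))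
      hf.cosine.continuous'.continuousOn
    obtain ⟨K3, h3⟩ := isCompact_Icc.exists_bound_of_continuousOn (s := Icc 0 (2 * h))
      hf.sine.continuous.continuousOn
    obtain ⟨K4, h4⟩ := isCompact_Icc.exists_bound_of_continuousOn (s := Icc 0 (2 * h))
      hf.sine.continuous'.continuousOn
    refine ⟨|K1| + |K2| + |K3| + |K4|, by positivity, fun t ht => ?_⟩
    have a1 := h1 t ht
    have a2 := h2 t ht
    have a3 := h3 t ht
    have a4 := h4 t ht
    rw [Real.norm_eq_abs] at a1 a2 a3 a4
    refine ⟨?_, ?_, ?_, ?_⟩ <;>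
    linarith [le_abs_self K1, le_abs_self K2, le_abs_self K3, le_abs_self K4, abs_nonneg K1,
      abs_nonneg K2, abs_nonneg K3, abs_nonneg K4]
  -- the coordinates of the translates stay on a level set of the invariant form
  have hiter : ∀ (a b : ℝ) (N : ℕ), ∃ a₁ b₁ : ℝ, P * a₁ ^ 2 - R * b₁ ^ 2 = P * a ^ 2 - R * b ^ 2 ∧
      ∀ t, a * c (t + 2 * h * N) + b * s (t + 2 * h * N) = a₁ * c t + b₁ * s t ∧
        a * c' (t + 2 * h * N) + b * s' (t + 2 * h * N) = a₁ * c' t + b₁ * s' t := by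
    intro a b N
    induction N with
    | zero => exact ⟨a, b, rfl, fun t => by simp⟩
    | succ N ih =>
      obtain ⟨a₁, b₁, hQ, ht⟩ := ih
      refine ⟨(2 * (c h * s' h) - 1) * a₁ + 2 * R * b₁, 2 * P * a₁ + (2 * (c h * s' h) - 1) * b₁,
        ?_, fun t => ?_⟩
      · have hT : (2 * (c h * s' h) - 1) ^ 2 - 4 * P * R = 1 := by
          rw [hP, hR]; linear_combination 4 * (c h * s' h) * w
        linear_combination (P * a₁ ^ 2 - R * b₁ ^ 2) * hT + hQ
      · have e1 := ht (t + 2 * h)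
        have e2 := hf.translate hq0 hqh a₁ b₁ t
        rw [show t + 2 * h * ((N + 1 : ℕ) : ℝ) = t + 2 * h + 2 * h * N by push_cast; ring]
        exact ⟨e1.1.trans e2.1, e1.2.trans e2.2⟩
  have hbound : ∀ a b : ℝ, ∃ B, ∀ t, 0 ≤ t →
      |a * c t + b * s t| ≤ B ∧ |a * c' t + b * s' t| ≤ B := by
    intro a b
    set D := P * (P * a ^ 2 - R * b ^ 2) with hD
    set A := √(D / P ^ 2) with hA
    set B := √(D / -(P * R)) with hB
    refine ⟨(A + B) * K, fun t ht => ?_⟩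
    obtain ⟨a₁, b₁, hQ, hts⟩ := hiter a b ⌊t / (2 * h)⌋₊
    have hP2 : 0 < P ^ 2 := by positivity
    have ha : |a₁| ≤ A := by
      refine Real.abs_le_sqrt ?_
      rw [le_div_iff₀ hP2, hD, ← hQ]
      nlinarith [sq_nonneg b₁]
    have hb : |b₁| ≤ B := by
      refine Real.abs_le_sqrt ?_
      rw [le_div_iff₀ (by linarith), hD, ← hQ]
      nlinarith [mul_nonneg hP2.le (sq_nonneg a₁)]
    set N := ⌊t / (2 * h)⌋₊ with hN
    have h2h : 0 < 2 * h := by linarith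
    have hN1 : (N : ℝ) ≤ t / (2 * h) := Nat.floor_le (by positivity)
    have hN2 : t / (2 * h) < N + 1 := Nat.lt_floor_add_one _
    rw [le_div_iff₀ h2h] at hN1
    rw [div_lt_iff₀ h2h] at hN2
    have hmem : t - 2 * h * N ∈ Icc 0 (2 * h) := ⟨by linarith, by linarith⟩
    obtain ⟨k1, k2, k3, k4⟩ := hK _ hmem
    have e := hts (t - 2 * h * N)
    rw [sub_add_cancel] at e
    have est : ∀ x y : ℝ, |x| ≤ K → |y| ≤ K → |a₁ * x + b₁ * y| ≤ (A + B) * K := by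
      intro x y hx hy
      calc |a₁ * x + b₁ * y| ≤ |a₁| * |x| + |b₁| * |y| := by
            rw [← abs_mul, ← abs_mul]; exact abs_add_le _ _
        _ ≤ A * K + B * K := add_le_add
            (mul_le_mul ha hx (abs_nonneg _) (Real.sqrt_nonneg _))
            (mul_le_mul hb hy (abs_nonneg _) (Real.sqrt_nonneg _))
        _ = (A + B) * K := by ring
    exact ⟨e.1 ▸ est _ _ k1 k3, e.2 ▸ est _ _ k2 k4⟩
  obtain ⟨B1, hB1⟩ := hbound 1 0
  obtain ⟨B2, hB2⟩ := hbound 0 1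
  simp only [one_mul, zero_mul, add_zero, zero_add] at hB1 hB2
  have hpos : ∀ t, 0 ≤ t → |c t| ≤ |B1| + |B2| ∧ |c' t| ≤ |B1| + |B2| ∧ |s t| ≤ |B1| + |B2| ∧
      |s' t| ≤ |B1| + |B2| := by
    intro t ht
    have i1 := hB1 t ht
    have i2 := hB2 t ht
    refine ⟨?_, ?_, ?_, ?_⟩ <;>
    linarith [i1.1, i1.2, i2.1, i2.2, le_abs_self B1, le_abs_self B2, abs_nonneg B1, abs_nonneg B2]
  refine ⟨|B1| + |B2|, fun t => ?_⟩
  rcases le_total 0 t with ht | ht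
  · exact hpos t ht
  · have := hpos (-t) (by linarith)
    obtain ⟨e1, e2, e3, e4⟩ := hf.even_odd hq0 t
    rwa [e1, e2, e3, e4, abs_neg, abs_neg] at this

/-- When `c(h) s'(h)` lies outside `[0, 1]` the monodromy matrix has a real eigenvalue of modulus
greater than `1`, and the corresponding solution grows geometrically. -/
theorem exists_unbounded (hf : IsFundamental q c c' s s') (hq0 : ∀ t, q (-t) = q t)
    (hqh : ∀ t, q (2 * h - t) = q t) (hh : 0 < h)
    (hX : (c h * s' h) * (1 - c h * s' h) < 0) :
    ∃ r : ℝ, ∀ C T : ℝ, ∃ t ≥ T, C < |c t + r * s t| := by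
  have w := hf.wronskian h
  have hPR : 0 < (c h * c' h) * (s h * s' h) := by
    have : (c h * c' h) * (s h * s' h) = -((c h * s' h) * (1 - c h * s' h)) := by
      linear_combination (-(c h * s' h)) * w
    linarith
  set P := c h * c' h with hP
  set R := s h * s' h with hR
  set T := 2 * (c h * s' h) - 1 with hT
  have hT2 : T ^ 2 = 1 + 4 * (P * R) := by
    rw [hP, hR, hT]; linear_combination 4 * (c h * s' h) * w
  have hR0 : R ≠ 0 := by rintro h0; rw [h0, mul_zero] at hPR; exact lt_irrefl _ hPR
  obtain ⟨r, hr, hsign⟩ : ∃ r, R * r ^ 2 = P ∧ 0 ≤ T * (R * r) := by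
    have hpos : 0 ≤ P / R := by
      rw [show P / R = P * R / R ^ 2 by field_simp]; positivity
    have hsq := Real.sq_sqrt hpos
    rcases le_total 0 (T * (R * √(P / R))) with h | h
    · exact ⟨√(P / R), by rw [hsq]; field_simp, h⟩
    · exact ⟨-√(P / R), by rw [neg_sq, hsq]; field_simp, by linarith⟩
  set lam := T + 2 * R * r with hlam
  have hlam1 : 1 < |lam| := by
    rw [← one_lt_sq_iff_one_lt_abs]
    nlinarith [sq_nonneg (R * r)]
  have hiter : ∀ N : ℕ, c (2 * h * N) + r * s (2 * h * N) = lam ^ N := by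
    intro N
    induction N with
    | zero => simp [hf.c_zero, hf.s_zero]
    | succ N ih =>
      have e := (hf.translate hq0 hqh 1 r (2 * h * N)).1
      rw [show 2 * h * ((N + 1 : ℕ) : ℝ) = 2 * h * N + 2 * h by push_cast; ring]
      rw [← hP, ← hR, ← hT] at e
      rw [pow_succ, ← ih]
      linear_combination e - 2 * s (2 * h * N) * hr
  refine ⟨r, fun C T₀ => ?_⟩
  obtain ⟨N₁, hN₁⟩ := ((tendsto_pow_atTop_atTop_of_one_lt hlam1).eventually_gt_atTop
    C).exists_forall_of_atTop
  obtain ⟨N₂, hN₂⟩ := exists_nat_ge (T₀ / (2 * h))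
  refine ⟨2 * h * (max N₁ N₂ : ℕ), ?_, ?_⟩
  · have h2 : (N₂ : ℝ) ≤ (max N₁ N₂ : ℕ) := by exact_mod_cast le_max_right _ _
    rw [div_le_iff₀ (by linarith)] at hN₂
    nlinarith
  · rw [hiter, abs_pow]
    exact hN₁ _ (le_max_left _ _)

end IsFundamental

namespace Plate

theorem stable_of_bounded_solutions {a v v' w w' : ℝ → ℝ} (hv : IsHillSolution a v v')
    (hw : IsHillSolution a w w') (hW : v 0 * w' 0 - v' 0 * w 0 ≠ 0) {B : ℝ}
    (hB : ∀ t ≥ 0, |v t| ≤ B ∧ |v' t| ≤ B ∧ |w t| ≤ B ∧ |w' t| ≤ B) :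
    HillStable a ∧ HillBounded a := by
  set W := v 0 * w' 0 - v' 0 * w 0 with hWdef
  have hB0 : 0 ≤ B := (abs_nonneg _).trans (hB 0 le_rfl).1
  have hWp : 0 < |W| := abs_pos.2 hW
  have key : ∀ ξ ξ' : ℝ → ℝ, IsHillSolution a ξ ξ' → ∀ t ≥ 0,
      |ξ t| + |ξ' t| ≤ 4 * B ^ 2 / |W| * (|ξ 0| + |ξ' 0|) := by
    intro ξ ξ' hξ t ht
    have h1 := hξ.wronskian_eq hw ht
    have h2 := hv.wronskian_eq hξ ht
    have h3 := hv.wronskian_eq hw ht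
    set X := ξ 0 * w' 0 - ξ' 0 * w 0
    set Y := v 0 * ξ' 0 - v' 0 * ξ 0
    have e1 : W * ξ t = X * v t + Y * w t := by
      linear_combination (-ξ t) * h3 + v t * h1 + w t * h2
    have e2 : W * ξ' t = X * v' t + Y * w' t := by
      linear_combination (-ξ' t) * h3 + v' t * h1 + w' t * h2
    obtain ⟨b1, b2, b3, b4⟩ := hB t ht
    obtain ⟨c1, c2, c3, c4⟩ := hB 0 le_rfl
    have est : ∀ p q x y M : ℝ, |x| ≤ B → |y| ≤ B → |p| + |q| ≤ M → |p * x + q * y| ≤ B * M := by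
      intro p q x y M hx hy hM
      calc |p * x + q * y| ≤ |p| * |x| + |q| * |y| := by
            rw [← abs_mul, ← abs_mul]; exact abs_add_le _ _
        _ ≤ |p| * B + |q| * B := by gcongr
        _ = B * (|p| + |q|) := by ring
        _ ≤ B * M := by gcongr
    have hX : |X| ≤ B * (|ξ 0| + |ξ' 0|) := by
      have := est (ξ 0) (-ξ' 0) (w' 0) (w 0) _ c4 c3 (le_of_eq (by rw [abs_neg]))
      rwa [show ξ 0 * w' 0 + -ξ' 0 * w 0 = X by ring] at this
    have hY : |Y| ≤ B * (|ξ 0| + |ξ' 0|) := by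
      have := est (ξ 0) (ξ' 0) (-v' 0) (v 0) _ (by rwa [abs_neg]) c1 le_rfl
      rwa [show ξ 0 * -v' 0 + ξ' 0 * v 0 = Y by ring] at this
    have hXY : |X| + |Y| ≤ 2 * B * (|ξ 0| + |ξ' 0|) := by linarith
    have f1 := est X Y _ _ _ b1 b3 hXY
    have f2 := est X Y _ _ _ b2 b4 hXY
    rw [← e1, abs_mul] at f1
    rw [← e2, abs_mul] at f2
    rw [div_mul_eq_mul_div, le_div_iff₀ hWp]
    nlinarith
  constructor
  · intro ε hε
    set M := 4 * B ^ 2 / |W| with hM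
    have hM0 : 0 ≤ M := by positivity
    refine ⟨ε / (M + 1), by positivity, fun ξ ξ' hξ h0 t ht => ?_⟩
    rw [lt_div_iff₀ (by positivity)] at h0
    have := key ξ ξ' hξ t ht
    nlinarith [abs_nonneg (ξ 0), abs_nonneg (ξ' 0)]
  · intro ξ ξ' hξ
    exact ⟨_, fun t ht => le_trans (le_add_of_nonneg_right (abs_nonneg _)) (key ξ ξ' hξ t ht)⟩

theorem unstable_of_unbounded_solution {a v v' : ℝ → ℝ} (hv : IsHillSolution a v v')
    (hun : ∀ C, ∃ t ≥ 0, C < |v t|) : ¬ HillStable a ∧ ¬ HillBounded a := by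
  constructor
  · intro hs
    obtain ⟨δ, hδ, hst⟩ := hs 1 one_pos
    set κ := δ / (|v 0| + |v' 0| + 1) with hκ
    have hκ0 : 0 < κ := by positivity
    have hsmul : IsHillSolution a (fun t => κ * v t) (fun t => κ * v' t) := fun t ht =>
      ⟨(hv t ht).1.const_mul κ, ((hv t ht).2.const_mul κ).congr_deriv (by ring)⟩
    obtain ⟨t, ht, hgt⟩ := hun (1 / κ)
    have := hst _ _ hsmul (by
      rw [abs_mul, abs_mul, abs_of_pos hκ0, ← mul_add, hκ, div_mul_eq_mul_div,
        div_lt_iff₀ (by positivity)]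
      nlinarith) t ht
    rw [abs_mul, abs_of_pos hκ0] at this
    rw [div_lt_iff₀ hκ0] at hgt
    nlinarith [abs_nonneg (κ * v' t)]
  · intro hb
    obtain ⟨C, hC⟩ := hb v v' hv
    obtain ⟨t, ht, hgt⟩ := hun C
    exact absurd (hC t ht) (not_le.2 hgt)

end Plate

/-! ### The limit equation -/

theorem IsDuffing.exists_quarter_period {ψ ψ' : ℝ → ℝ} (h : IsDuffing 0 ψ ψ') :
    ∃ b > 0, ψ b = 0 ∧ (∀ t ∈ Ico 0 b, 0 < ψ t) ∧ (∀ t ∈ Ioc 0 b, ψ' t < 0) := by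
  have hanti : ∀ b, (∀ t ∈ Ico 0 b, 0 < ψ t) → StrictAntiOn ψ' (Icc 0 b) := fun b hb =>
    strictAntiOn_of_deriv_neg (convex_Icc 0 b) h.continuous'.continuousOn fun t ht => by
      rw [interior_Icc] at ht
      have := hb t (Ioo_subset_Ico_self ht)
      rw [(h.deriv' t).deriv]
      have : 0 < ψ t ^ 3 := by positivity
      linarith
  obtain ⟨t₁, ht₁, hneg⟩ : ∃ t₁ ≥ 0, ψ t₁ ≤ 0 := by
    by_contra! hpos
    have hA : ∀ b, StrictAntiOn ψ' (Icc 0 b) := fun b => hanti b fun t ht => hpos t ht.1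
    have h1 : ψ' 1 < 0 := by
      have := hA 1 ⟨le_rfl, zero_le_one⟩ ⟨zero_le_one, le_rfl⟩ zero_lt_one
      rwa [h.init'] at this
    set d := -ψ' 1 with hd
    have hd0 : 0 < d := by linarith
    have hT : (1 : ℝ) ≤ 1 + ψ 1 / d := by
      have := hpos 1 zero_le_one
      have : 0 < ψ 1 / d := by positivity
      linarith
    have := (convex_Icc (1 : ℝ) (1 + ψ 1 / d)).image_sub_le_mul_sub_of_deriv_le
      h.continuous.continuousOn (fun t _ => (h.deriv t).differentiableAt.differentiableWithinAt)
      (C := -d) (fun t ht => by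
        rw [interior_Icc] at ht
        rw [(h.deriv t).deriv, hd, neg_neg]
        exact ((hA t).antitoneOn ⟨zero_le_one, ht.1.le⟩ ⟨by linarith [ht.1], le_rfl⟩ ht.1.le))
      1 ⟨le_rfl, hT⟩ (1 + ψ 1 / d) ⟨hT, le_rfl⟩ hT
    have e : -d * (1 + ψ 1 / d - 1) = -ψ 1 := by field_simp; ring
    rw [e] at this
    linarith [hpos (1 + ψ 1 / d) (by linarith)]
  obtain ⟨b, hb, hb0, hpos⟩ := exists_first_zero h.continuous ht₁ (by rw [h.init]; norm_num) hneg
  refine ⟨b, hb.1, hb0, hpos, fun t ht => ?_⟩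
  have := hanti b hpos ⟨le_rfl, hb.1.le⟩ ⟨ht.1.le, ht.2⟩ ht.1
  rwa [h.init'] at this

theorem IsDuffing.linearSolution {ψ ψ' : ℝ → ℝ} (h : IsDuffing 0 ψ ψ') :
    IsLinearSolution (fun t => 1 * ψ t ^ 2) ψ ψ' := fun t =>
  ⟨h.deriv t, (h.deriv' t).congr_deriv (by ring)⟩

theorem IsDuffing.linearSolution_deriv {ψ ψ' : ℝ → ℝ} (h : IsDuffing 0 ψ ψ') :
    IsLinearSolution (fun t => 3 * ψ t ^ 2) (fun t => -ψ' t) (fun t => ψ t ^ 3) := fun t =>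
  ⟨(h.deriv' t).neg.congr_deriv (by ring), ((h.deriv t).pow 3).congr_deriv (by push_cast; ring)⟩

section Base

variable {ψ ψ' : ℝ → ℝ} {b γ : ℝ} {c c' s s' : ℝ → ℝ}

/-- Sturm comparison with `ψ'`, which solves the equation with `γ = 3`. -/
theorem sine_deriv_pos (h : IsDuffing 0 ψ ψ') (hpos : ∀ t ∈ Ico 0 b, 0 < ψ t)
    (hψb : ψ b = 0) (hneg : ∀ t ∈ Ioc 0 b, ψ' t < 0)
    (hf : IsFundamental (fun t => γ * ψ t ^ 2) c c' s s') (hγ : γ < 3) :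
    ∀ t ∈ Icc 0 b, 0 < s' t := by
  intro t₁ ht₁
  by_contra! hle
  obtain ⟨τ, hτ, hτ0, hτpos⟩ := exists_first_zero hf.sine.continuous' ht₁.1
    (by rw [hf.s'_zero]; norm_num) hle
  have hτb : τ ≤ b := hτ.2.trans ht₁.2
  have hs : StrictMonoOn s (Icc 0 τ) :=
    strictMonoOn_of_deriv_pos (convex_Icc 0 τ) hf.sine.continuous.continuousOn fun t ht => by
      rw [interior_Icc] at ht
      rw [(hf.sine t).1.deriv]
      exact hτpos t (Ioo_subset_Ico_self ht)
  have hspos : ∀ t ∈ Ioc 0 τ, 0 < s t := fun t ht => by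
    have := hs ⟨le_rfl, hτ.1.le⟩ ⟨ht.1.le, ht.2⟩ ht.1
    rwa [hf.s_zero] at this
  have hW := fun t => hf.sine.wronskian_hasDerivAt h.linearSolution_deriv t
  have hWanti : StrictAntiOn (fun t => s t * ψ t ^ 3 - s' t * -ψ' t) (Icc 0 τ) :=
    strictAntiOn_of_deriv_neg (convex_Icc 0 τ)
      (fun t _ => (hW t).continuousAt.continuousWithinAt) fun t ht => by
      rw [interior_Icc] at ht
      rw [(hW t).deriv]
      have h1 := hpos t ⟨ht.1.le, ht.2.trans_le hτb⟩
      have h2 := hneg t ⟨ht.1, ht.2.le.trans hτb⟩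
      have h3 := hspos t ⟨ht.1, ht.2.le⟩
      have h4 : 0 < (3 - γ) * (ψ t ^ 2 * (s t * -ψ' t)) := by
        have : 0 < -ψ' t := by linarith
        have : 0 < 3 - γ := by linarith
        positivity
      linarith
  have := hWanti ⟨le_rfl, hτ.1.le⟩ ⟨hτ.1.le, le_rfl⟩ hτ.1
  simp only [hτ0, hf.s_zero, hf.s'_zero, h.init'] at this
  have h1 := hspos τ ⟨hτ.1, le_rfl⟩
  have h2 : 0 ≤ ψ τ := by
    rcases hτb.lt_or_eq with h' | h'
    · exact (hpos τ ⟨hτ.1.le, h'⟩).le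
    · rw [h', hψb]
  have : 0 ≤ s τ * ψ τ ^ 3 := by positivity
  linarith

theorem sine_pos (hf : IsFundamental (fun t => γ * ψ t ^ 2) c c' s s')
    (hs' : ∀ t ∈ Icc 0 b, 0 < s' t) : ∀ t ∈ Ioc 0 b, 0 < s t := by
  intro t ht
  have hs : StrictMonoOn s (Icc 0 b) :=
    strictMonoOn_of_deriv_pos (convex_Icc 0 b) hf.sine.continuous.continuousOn fun t ht => by
      rw [interior_Icc] at ht
      rw [(hf.sine t).1.deriv]
      exact hs' t (Ioo_subset_Icc_self ht)
  have := hs ⟨le_rfl, ht.1.le.trans ht.2⟩ ⟨ht.1.le, ht.2⟩ ht.1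
  rwa [hf.s_zero] at this

/-- As long as `c` is positive it is strictly concave. -/
theorem cosine_deriv_neg (hpos : ∀ t ∈ Ico 0 b, 0 < ψ t)
    (hf : IsFundamental (fun t => γ * ψ t ^ 2) c c' s s') (hγ : 0 < γ) {τ : ℝ} (hτ0 : 0 < τ)
    (hτb : τ ≤ b) (hc : ∀ t ∈ Ico 0 τ, 0 < c t) : c' τ < 0 := by
  have hanti : StrictAntiOn c' (Icc 0 τ) :=
    strictAntiOn_of_deriv_neg (convex_Icc 0 τ) hf.cosine.continuous'.continuousOn fun t ht => by
      rw [interior_Icc] at ht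
      rw [(hf.cosine t).2.deriv]
      have h1 := hpos t ⟨ht.1.le, ht.2.trans_le hτb⟩
      have h2 := hc t ⟨ht.1.le, ht.2⟩
      have : 0 < γ * ψ t ^ 2 * c t := by positivity
      linarith
  have := hanti ⟨le_rfl, hτ0.le⟩ ⟨hτ0.le, le_rfl⟩ hτ0
  rwa [hf.c'_zero] at this

/-- Sturm comparison with `ψ`, which solves the equation with `γ = 1`. -/
theorem cosine_pos (h : IsDuffing 0 ψ ψ') (hpos : ∀ t ∈ Ico 0 b, 0 < ψ t) (hψb : ψ b = 0)
    (hf : IsFundamental (fun t => γ * ψ t ^ 2) c c' s s') (hγ0 : 0 < γ) (hγ : γ < 1) :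
    ∀ t ∈ Icc 0 b, 0 < c t := by
  intro t₁ ht₁
  by_contra! hle
  obtain ⟨τ, hτ, hτ0, hτpos⟩ := exists_first_zero hf.cosine.continuous ht₁.1
    (by rw [hf.c_zero]; norm_num) hle
  have hτb : τ ≤ b := hτ.2.trans ht₁.2
  have hW := fun t => hf.cosine.wronskian_hasDerivAt h.linearSolution t
  have hWanti : StrictAntiOn (fun t => c t * ψ' t - c' t * ψ t) (Icc 0 τ) :=
    strictAntiOn_of_deriv_neg (convex_Icc 0 τ)
      (fun t _ => (hW t).continuousAt.continuousWithinAt) fun t ht => by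
      rw [interior_Icc] at ht
      rw [(hW t).deriv]
      have h1 := hpos t ⟨ht.1.le, ht.2.trans_le hτb⟩
      have h2 := hτpos t ⟨ht.1.le, ht.2⟩
      have : 0 < 1 - γ := by linarith
      have h4 : 0 < (1 - γ) * (ψ t ^ 2 * (c t * ψ t)) := by positivity
      linarith
  have := hWanti ⟨le_rfl, hτ.1.le⟩ ⟨hτ.1.le, le_rfl⟩ hτ.1
  simp only [hτ0, hf.c_zero, hf.c'_zero, h.init'] at this
  have h1 := cosine_deriv_neg hpos hf hγ0 hτ.1 hτb hτpos
  have h2 : 0 ≤ ψ τ := by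
    rcases hτb.lt_or_eq with h' | h'
    · exact (hpos τ ⟨hτ.1.le, h'⟩).le
    · rw [h', hψb]
  nlinarith

/-- For `1 < γ < 3` the solution `c` changes sign before `ψ` does, and then stays negative because
`c / s` decreases. -/
theorem cosine_neg (h : IsDuffing 0 ψ ψ') (hb : 0 < b) (hpos : ∀ t ∈ Ico 0 b, 0 < ψ t)
    (hψb : ψ b = 0) (hneg : ∀ t ∈ Ioc 0 b, ψ' t < 0)
    (hf : IsFundamental (fun t => γ * ψ t ^ 2) c c' s s') (hγ1 : 1 < γ) (hγ : γ < 3) :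
    c b < 0 := by
  have hspos := sine_pos hf (sine_deriv_pos h hpos hψb hneg hf hγ)
  by_cases hc : ∀ t ∈ Ico 0 b, 0 < c t
  · have hW := fun t => hf.cosine.wronskian_hasDerivAt h.linearSolution t
    have hWmono : StrictMonoOn (fun t => c t * ψ' t - c' t * ψ t) (Icc 0 b) :=
      strictMonoOn_of_deriv_pos (convex_Icc 0 b)
        (fun t _ => (hW t).continuousAt.continuousWithinAt) fun t ht => by
        rw [interior_Icc] at ht
        rw [(hW t).deriv]
        have h1 := hpos t (Ioo_subset_Ico_self ht)
        have h2 := hc t (Ioo_subset_Ico_self ht)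
        have : 0 < γ - 1 := by linarith
        have h4 : 0 < (γ - 1) * (ψ t ^ 2 * (c t * ψ t)) := by positivity
        linarith
    have := hWmono ⟨le_rfl, hb.le⟩ ⟨hb.le, le_rfl⟩ hb
    simp only [hψb, hf.c_zero, hf.c'_zero, h.init'] at this
    have h2 := hneg b ⟨hb, le_rfl⟩
    nlinarith
  · push Not at hc
    obtain ⟨t₁, ht₁, hle⟩ := hc
    obtain ⟨τ, hτ, hτ0, -⟩ := exists_first_zero hf.cosine.continuous ht₁.1
      (by rw [hf.c_zero]; norm_num) hle
    have hτb : τ < b := hτ.2.trans_lt ht₁.2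
    have hquot : ∀ t ∈ Icc τ b, HasDerivAt (fun t => c t / s t) (-1 / s t ^ 2) t := by
      intro t ht
      have h0 := hspos t ⟨hτ.1.trans_le ht.1, ht.2⟩
      refine ((hf.cosine t).1.div (hf.sine t).1 h0.ne').congr_deriv ?_
      rw [show c' t * s t - c t * s' t = -1 by linarith [hf.wronskian t]]
    have hanti : StrictAntiOn (fun t => c t / s t) (Icc τ b) :=
      strictAntiOn_of_deriv_neg (convex_Icc τ b)
        (fun t ht => (hquot t ht).continuousAt.continuousWithinAt) fun t ht => by
        rw [interior_Icc] at ht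
        have ht' := Ioo_subset_Icc_self ht
        rw [(hquot t ht').deriv]
        have h0 := hspos t ⟨hτ.1.trans_le ht'.1, ht'.2⟩
        exact div_neg_of_neg_of_pos (by norm_num) (by positivity)
    have := hanti ⟨le_rfl, hτb.le⟩ ⟨hτb.le, le_rfl⟩ hτb
    simp only [hτ0, zero_div] at this
    have h0 := hspos b ⟨hb, le_rfl⟩
    by_contra! hge
    exact absurd this (not_lt.2 (by positivity))

end Base

/-- The operator `ξ ↦ (p + 1) ψ' ξ + ψ ξ'` maps solutions of `ξ'' + p (p + 1) / 2 ψ² ξ = 0` to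
solutions of the same equation with `p + 2` in place of `p`. -/
theorem IsLinearSolution.raise {ψ ψ' ξ ξ' : ℝ → ℝ} (h : IsDuffing 0 ψ ψ') {p : ℝ}
    (hξ : IsLinearSolution (fun t => p * (p + 1) / 2 * ψ t ^ 2) ξ ξ') :
    IsLinearSolution (fun t => (p + 2) * (p + 3) / 2 * ψ t ^ 2)
      (fun t => (p + 1) * (ψ' t * ξ t) + ψ t * ξ' t)
      (fun t => (p + 2) * (ψ' t * ξ' t - (p + 1) / 2 * (ψ t ^ 3 * ξ t))) := by
  intro t
  refine ⟨((((h.deriv' t).mul (hξ t).1).const_mul (p + 1)).add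
    ((h.deriv t).mul (hξ t).2)).congr_deriv (by ring),
    ((((h.deriv' t).mul (hξ t).2).sub ((((h.deriv t).pow 3).mul (hξ t).1).const_mul
      ((p + 1) / 2))).const_mul (p + 2)).congr_deriv ?_⟩
  simp only [Pi.pow_apply]
  push_cast
  ring

/-- The raising operator exchanges, up to factors, the even and the odd solution; hence
`X = c(b) s'(b)` is replaced by `1 - X`. -/
theorem raise_value {ψ ψ' : ℝ → ℝ} (h : IsDuffing 0 ψ ψ') {b : ℝ} (hψb : ψ b = 0) {p : ℝ}
    (hp : 0 ≤ p) {c c' s s' C C' D D' : ℝ → ℝ}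
    (hf : IsFundamental (fun t => p * (p + 1) / 2 * ψ t ^ 2) c c' s s')
    (hF : IsFundamental (fun t => (p + 2) * (p + 3) / 2 * ψ t ^ 2) C C' D D') :
    C b * D' b = 1 - c b * s' b := by
  have hE := h.energy_eq b
  have e1 := hF.eq_combination (hf.cosine.raise h) b
  have e2 := hF.eq_combination (hf.sine.raise h) b
  simp only [h.init, h.init', hψb, hf.c_zero, hf.c'_zero, hf.s_zero, hf.s'_zero] at e1 e2 hE
  have k1 := e1.2
  have k2 := e2.1
  have w := hf.wronskian b
  have hD : (p + 1) * D' b = -2 * (ψ' b * c' b) := by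
    have hp2 : (p + 2) ≠ 0 := by positivity
    refine mul_left_cancel₀ hp2 ?_
    linear_combination 2 * k1
  have hC : C b = (p + 1) * (ψ' b * s b) := by linear_combination -k2
  rw [hC]
  linear_combination (ψ' b * s b) * hD - 2 * s b * c' b * hE + w

/-- The sign of `X (1 - X)`, `X = c(b) s'(b)`, for the limit equation with `γ = p (p + 1) / 2`:
positive for `p` in `(2 j, 2 j + 1)` and negative for `p` in `(2 j + 1, 2 j + 2)`. -/
theorem limit_sign {ψ ψ' : ℝ → ℝ} (h : IsDuffing 0 ψ ψ') {b : ℝ} (hb : 0 < b) (hψb : ψ b = 0)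
    (hpos : ∀ t ∈ Ico 0 b, 0 < ψ t) (hneg : ∀ t ∈ Ioc 0 b, ψ' t < 0) (j : ℕ) :
    ∀ (p : ℝ) (c c' s s' : ℝ → ℝ), IsFundamental (fun t => p * (p + 1) / 2 * ψ t ^ 2) c c' s s' →
      (p ∈ Ioo (2 * j : ℝ) (2 * j + 1) → 0 < (c b * s' b) * (1 - c b * s' b)) ∧
      (p ∈ Ioo (2 * j + 1 : ℝ) (2 * j + 2) → (c b * s' b) * (1 - c b * s' b) < 0) := by
  induction j with
  | zero =>
    intro p c c' s s' hf
    have w := hf.wronskian b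
    simp only [Nat.cast_zero, mul_zero, zero_add]
    constructor
    · rintro ⟨hp0, hp1⟩
      have hγ0 : 0 < p * (p + 1) / 2 := by positivity
      have hγ1 : p * (p + 1) / 2 < 1 := by nlinarith
      have hs' := sine_deriv_pos h hpos hψb hneg hf (by linarith)
      have hs := sine_pos hf hs' b ⟨hb, le_rfl⟩
      have hs'b := hs' b ⟨hb.le, le_rfl⟩
      have hc := cosine_pos h hpos hψb hf hγ0 hγ1
      have hcb := hc b ⟨hb.le, le_rfl⟩
      have hc' := cosine_deriv_neg hpos hf hγ0 hb le_rfl fun t ht => hc t (Ico_subset_Icc_self ht)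
      have h1 : 0 < 1 - c b * s' b := by nlinarith
      positivity
    · rintro ⟨hp0, hp1⟩
      have hγ1 : 1 < p * (p + 1) / 2 := by nlinarith
      have hγ3 : p * (p + 1) / 2 < 3 := by nlinarith
      have hs'b := sine_deriv_pos h hpos hψb hneg hf hγ3 b ⟨hb.le, le_rfl⟩
      have hcb := cosine_neg h hb hpos hψb hneg hf hγ1 hγ3
      have h1 : c b * s' b < 0 := mul_neg_of_neg_of_pos hcb hs'b
      exact mul_neg_of_neg_of_pos h1 (by linarith)
  | succ j ih =>
    intro p C C' D D' hF
    have red : 2 * (j + 1 : ℝ) < p → ∃ c c' s s' : ℝ → ℝ,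
        IsFundamental (fun t => (p - 2) * (p - 2 + 1) / 2 * ψ t ^ 2) c c' s s' ∧
        C b * D' b = 1 - c b * s' b := by
      intro hp
      obtain ⟨c, c', s, s', hf⟩ := exists_isFundamental
        (q := fun t => (p - 2) * (p - 2 + 1) / 2 * ψ t ^ 2)
        (B := |(p - 2) * (p - 2 + 1) / 2|) (by have := h.continuous; fun_prop) (fun t => by
          have h1 : |ψ t ^ 2| ≤ 1 := by
            rw [abs_pow]; exact pow_le_one₀ (abs_nonneg _) (h.abs_le_one le_rfl t)
          rw [abs_mul]
          exact mul_le_of_le_one_right (abs_nonneg _) h1)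
      refine ⟨c, c', s, s', hf, raise_value (C' := C') (D := D) h hψb ?_ hf ?_⟩
      · have : (0 : ℝ) ≤ j := Nat.cast_nonneg j
        linarith
      · rw [show p - 2 + 2 = p by ring, show p - 2 + 3 = p + 1 by ring]
        exact hF
    push_cast
    constructor
    · rintro ⟨h1, h2⟩
      obtain ⟨c, c', s, s', hf, e⟩ := red h1
      have := (ih _ _ _ _ _ hf).1 ⟨by linarith, by linarith⟩
      rw [e]; linarith
    · rintro ⟨h1, h2⟩
      obtain ⟨c, c', s, s', hf, e⟩ := red (by linarith)
      have := (ih _ _ _ _ _ hf).2 ⟨by linarith, by linarith⟩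
      rw [e]; linarith

/-! ### Dependence on parameters -/

theorem abs_le_mul_exp {d d' d'' : ℝ → ℝ} {K δ η T : ℝ} (hK : 1 ≤ K) (hδ : 0 ≤ δ) (hη : 0 ≤ η)
    (hd : ∀ t ∈ Ici (0 : ℝ), HasDerivWithinAt d (d' t) (Ici 0) t)
    (hd' : ∀ t ∈ Ici (0 : ℝ), HasDerivWithinAt d' (d'' t) (Ici 0) t)
    (h : ∀ t ∈ Ico 0 T, |d'' t| ≤ K * |d t| + η) (h0 : |d 0| ≤ δ) (h0' : |d' 0| ≤ δ) :
    ∀ t ∈ Icc 0 T, |d t| ≤ (δ + η) * Real.exp (K * T) ∧ |d' t| ≤ (δ + η) * Real.exp (K * T) := by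
  intro t ht
  have key : gronwallBound δ K η t ≤ (δ + η) * Real.exp (K * T) := by
    rw [gronwallBound_of_K_ne_0 (by linarith)]
    have h1 : Real.exp (K * t) ≤ Real.exp (K * T) := by
      gcongr
      exact ht.2
    have h2 : 1 ≤ Real.exp (K * t) := Real.one_le_exp (mul_nonneg (by linarith) ht.1)
    have h3 : η / K ≤ η := div_le_self hη hK
    have h4 : η / K * (Real.exp (K * t) - 1) ≤ η * (Real.exp (K * t) - 1) := by
      gcongr
    nlinarith
  have := abs_le_gronwallBound hK hη hd hd' h h0 h0' t ht
  exact ⟨this.1.trans key, this.2.trans key⟩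

theorem duffing_unique {α β : ℝ} {x x' y y' : ℝ → ℝ}
    (hx : ∀ t ∈ Ici (0 : ℝ), HasDerivWithinAt x (x' t) (Ici 0) t ∧
      HasDerivWithinAt x' (-α * x t - β * x t ^ 3) (Ici 0) t)
    (hy : ∀ t ∈ Ici (0 : ℝ), HasDerivWithinAt y (y' t) (Ici 0) t ∧
      HasDerivWithinAt y' (-α * y t - β * y t ^ 3) (Ici 0) t)
    (h0 : x 0 = y 0) (h0' : x' 0 = y' 0) {t : ℝ} (ht : 0 ≤ t) : x t = y t ∧ x' t = y' t := by
  obtain ⟨M, hM⟩ := isCompact_Icc.exists_bound_of_continuousOn (s := Icc 0 t) (f := x)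
    fun s hs => (hx s hs.1).1.continuousWithinAt.mono Icc_subset_Ici_self
  obtain ⟨N, hN⟩ := isCompact_Icc.exists_bound_of_continuousOn (s := Icc 0 t) (f := y)
    fun s hs => (hy s hs.1).1.continuousWithinAt.mono Icc_subset_Ici_self
  have hM0 : 0 ≤ M := (norm_nonneg _).trans (hM 0 ⟨le_rfl, ht⟩)
  have hN0 : 0 ≤ N := (norm_nonneg _).trans (hN 0 ⟨le_rfl, ht⟩)
  have := abs_le_mul_exp (d := fun s => x s - y s) (d' := fun s => x' s - y' s)
    (d'' := fun s => (-α * x s - β * x s ^ 3) - (-α * y s - β * y s ^ 3))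
    (K := 1 + |α| + |β| * (M ^ 2 + M * N + N ^ 2)) (δ := 0) (η := 0) (T := t)
    (by have := abs_nonneg α; have : 0 ≤ |β| * (M ^ 2 + M * N + N ^ 2) := by positivity
        linarith) le_rfl le_rfl
    (fun s hs => (hx s hs).1.sub (hy s hs).1) (fun s hs => (hx s hs).2.sub (hy s hs).2)
    (by
      intro s hs
      have hxs := hM s (Ico_subset_Icc_self hs)
      have hys := hN s (Ico_subset_Icc_self hs)
      rw [Real.norm_eq_abs] at hxs hys
      have h1 : |x s ^ 2 + x s * y s + y s ^ 2| ≤ M ^ 2 + M * N + N ^ 2 := by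
        refine (abs_add_three _ _ _).trans ?_
        rw [abs_mul, abs_pow, abs_pow]
        gcongr
      have h2 : |-(α + β * (x s ^ 2 + x s * y s + y s ^ 2))| ≤
          |α| + |β| * (M ^ 2 + M * N + N ^ 2) := by
        rw [abs_neg]
        refine (abs_add_le _ _).trans ?_
        rw [abs_mul]
        gcongr
      rw [show (-α * x s - β * x s ^ 3) - (-α * y s - β * y s ^ 3)
        = -(α + β * (x s ^ 2 + x s * y s + y s ^ 2)) * (x s - y s) by ring, abs_mul]
      nlinarith [abs_nonneg (x s - y s)])
    (by simp [h0]) (by simp [h0']) t ⟨ht, le_rfl⟩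
  simp only [add_zero, zero_mul] at this
  exact ⟨sub_eq_zero.1 (abs_nonpos_iff.1 this.1), sub_eq_zero.1 (abs_nonpos_iff.1 this.2)⟩

namespace IsDuffing

variable {ε : ℝ} {ψ ψ' : ℝ → ℝ}

/-- The affine change of time `t ↦ ω t + b` and multiplication by `A` turn a solution of the
normalized equation into one of `x'' + α x + β x³ = 0`. -/
theorem comp_affine (h : IsDuffing ε ψ ψ') {A ω b α β : ℝ} (hα : ε * ω ^ 2 = α)
    (hβ : ω ^ 2 = β * A ^ 2) (t : ℝ) :
    HasDerivAt (fun t => A * ψ (ω * t + b)) (A * (ω * ψ' (ω * t + b))) t ∧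
      HasDerivAt (fun t => A * (ω * ψ' (ω * t + b)))
        (-α * (A * ψ (ω * t + b)) - β * (A * ψ (ω * t + b)) ^ 3) t := by
  have hd : HasDerivAt (fun t => ω * t + b) ω t := by
    simpa using ((hasDerivAt_id t).const_mul ω).add_const b
  refine ⟨(((h.deriv (ω * t + b)).comp t hd).const_mul A).congr_deriv (by ring),
    ((((h.deriv' (ω * t + b)).comp t hd).const_mul ω).const_mul A).congr_deriv ?_⟩
  rw [← hα]
  linear_combination (-A * ψ (ω * t + b) ^ 3) * hβ

theorem even_of_nonneg (h : IsDuffing ε ψ ψ') {t : ℝ} (ht : 0 ≤ t) :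
    ψ t = ψ (-t) ∧ ψ' t = -ψ' (-t) := by
  have h1 := fun t => h.comp_affine (A := 1) (ω := 1) (b := 0) (α := ε) (β := 1) (by ring)
    (by ring) t
  have h2 := fun t => h.comp_affine (A := 1) (ω := -1) (b := 0) (α := ε) (β := 1) (by ring)
    (by ring) t
  have := duffing_unique (fun t _ => ⟨(h1 t).1.hasDerivWithinAt, (h1 t).2.hasDerivWithinAt⟩)
    (fun t _ => ⟨(h2 t).1.hasDerivWithinAt, (h2 t).2.hasDerivWithinAt⟩) (by simp)
    (by simp [h.init']) ht
  simpa using this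

theorem even (h : IsDuffing ε ψ ψ') (t : ℝ) : ψ (-t) = ψ t ∧ ψ' (-t) = -ψ' t := by
  rcases le_total 0 t with ht | ht
  · have := h.even_of_nonneg ht
    exact ⟨this.1.symm, by linarith [this.2]⟩
  · have := h.even_of_nonneg (t := -t) (by linarith)
    rw [neg_neg] at this
    exact this

/-- A solution is odd about each of its zeros. -/
theorem reflect (h : IsDuffing ε ψ ψ') {b : ℝ} (hb : ψ b = 0) (t : ℝ) :
    ψ (2 * b - t) = -ψ t := by
  have h1 := fun t => h.comp_affine (A := 1) (ω := 1) (b := b) (α := ε) (β := 1) (by ring)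
    (by ring) t
  have h2 := fun t => h.comp_affine (A := -1) (ω := -1) (b := b) (α := ε) (β := 1) (by ring)
    (by ring) t
  have key : ∀ t, 0 ≤ t → ψ (b + t) = -ψ (b - t) := fun t ht => by
    have := (duffing_unique (fun t _ => ⟨(h1 t).1.hasDerivWithinAt, (h1 t).2.hasDerivWithinAt⟩)
      (fun t _ => ⟨(h2 t).1.hasDerivWithinAt, (h2 t).2.hasDerivWithinAt⟩) (by simp [hb])
      (by simp) ht).1
    simp only [one_mul, neg_mul] at this
    rwa [add_comm t b, neg_add_eq_sub] at this
  rcases le_total t b with ht | ht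
  · have := key (b - t) (by linarith)
    rwa [show b + (b - t) = 2 * b - t by ring, sub_sub_cancel] at this
  · have := key (t - b) (by linarith)
    rw [show b + (t - b) = t by ring, show b - (t - b) = 2 * b - t by ring] at this
    linarith

/-- The orbit passes through every point of its energy level. -/
theorem exists_phase (h : IsDuffing ε ψ ψ') (hε : 0 ≤ ε) {b : ℝ} (hb0 : 0 < b) (hb : ψ b = 0)
    {x y : ℝ} (hxy : y ^ 2 + ε * x ^ 2 + x ^ 4 / 2 = ε + 1 / 2) :
    ∃ t, ψ t = x ∧ ψ' t = y := by
  have hx : |x| ≤ 1 := by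
    rw [← sq_le_one_iff_abs_le_one]
    by_contra! hgt
    nlinarith [sq_nonneg y, mul_nonneg hε (sub_nonneg.2 hgt.le)]
  rw [abs_le] at hx
  have h2b : ψ (2 * b) = -1 := by
    have := h.reflect hb 0
    rwa [sub_zero, h.init] at this
  obtain ⟨t, -, ht⟩ := intermediate_value_Icc' (a := 0) (b := 2 * b) (by linarith)
    h.continuous.continuousOn (show x ∈ Icc (ψ (2 * b)) (ψ 0) by
      rw [h2b, h.init]; exact hx)
  have hE := h.energy_eq t
  rw [ht] at hE
  have hsq : ψ' t ^ 2 = y ^ 2 := by linarith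
  rcases sq_eq_sq_iff_eq_or_eq_neg.1 hsq with h1 | h1
  · exact ⟨t, ht, h1⟩
  · obtain ⟨e1, e2⟩ := h.even t
    exact ⟨-t, by rw [e1, ht], by rw [e2, h1, neg_neg]⟩

/-- The distance to the solution of the limit equation is of order `ε`. -/
theorem abs_sub_le (h : IsDuffing ε ψ ψ') (hε : 0 ≤ ε) {ψ₀ ψ₀' : ℝ → ℝ} (h₀ : IsDuffing 0 ψ₀ ψ₀')
    {T t : ℝ} (ht : t ∈ Icc 0 T) : |ψ t - ψ₀ t| ≤ ε * Real.exp (3 * T) := by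
  have := abs_le_mul_exp (d := fun s => ψ s - ψ₀ s) (d' := fun s => ψ' s - ψ₀' s)
    (d'' := fun s => (-(ε * ψ s) - ψ s ^ 3) - (-(0 * ψ₀ s) - ψ₀ s ^ 3))
    (K := 3) (δ := 0) (η := ε) (T := T) (by norm_num) le_rfl hε
    (fun s _ => ((h.deriv s).sub (h₀.deriv s)).hasDerivWithinAt)
    (fun s _ => ((h.deriv' s).sub (h₀.deriv' s)).hasDerivWithinAt)
    (by
      intro s _
      have hx := h.abs_le_one hε s
      have hy := h₀.abs_le_one le_rfl s
      have h1 : |ψ s ^ 2 + ψ s * ψ₀ s + ψ₀ s ^ 2| ≤ 3 := by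
        refine (abs_add_three _ _ _).trans ?_
        rw [abs_mul, abs_pow, abs_pow]
        nlinarith [abs_nonneg (ψ s), abs_nonneg (ψ₀ s)]
      have e : (-(ε * ψ s) - ψ s ^ 3) - (-(0 * ψ₀ s) - ψ₀ s ^ 3)
        = -((ψ s ^ 2 + ψ s * ψ₀ s + ψ₀ s ^ 2) * (ψ s - ψ₀ s)) + -(ε * ψ s) := by ring
      rw [e]
      refine (abs_add_le _ _).trans ?_
      rw [abs_neg, abs_neg, abs_mul, abs_mul, abs_of_nonneg hε]
      nlinarith [abs_nonneg (ψ s - ψ₀ s)])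
    (by simp [h.init, h₀.init]) (by simp [h.init', h₀.init']) t ht
  simpa using this.1

end IsDuffing

theorem IsLinearSolution.abs_sub_le {q q₀ u u' u₀ u₀' : ℝ → ℝ} (hu : IsLinearSolution q u u')
    (hu₀ : IsLinearSolution q₀ u₀ u₀') (h0 : u 0 = u₀ 0) (h0' : u' 0 = u₀' 0) {K M η T : ℝ}
    (hK : 1 ≤ K) (hη : 0 ≤ η) (hM : 0 ≤ M) (hq : ∀ t ∈ Icc 0 T, |q t| ≤ K)
    (hqq : ∀ t ∈ Icc 0 T, |q t - q₀ t| ≤ η) (hb : ∀ t ∈ Icc 0 T, |u₀ t| ≤ M) :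
    ∀ t ∈ Icc 0 T, |u t - u₀ t| ≤ η * M * Real.exp (K * T) ∧
      |u' t - u₀' t| ≤ η * M * Real.exp (K * T) := by
  intro t ht
  have := abs_le_mul_exp (d := fun s => u s - u₀ s) (d' := fun s => u' s - u₀' s)
    (d'' := fun s => -(q s * u s) - -(q₀ s * u₀ s))
    (K := K) (δ := 0) (η := η * M) (T := T) hK le_rfl (by positivity)
    (fun s _ => ((hu s).1.sub (hu₀ s).1).hasDerivWithinAt)
    (fun s _ => ((hu s).2.sub (hu₀ s).2).hasDerivWithinAt)
    (by
      intro s hs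
      have hs' := Ico_subset_Icc_self hs
      have e : -(q s * u s) - -(q₀ s * u₀ s) = -(q s * (u s - u₀ s)) + -((q s - q₀ s) * u₀ s) := by
        ring
      rw [e]
      refine (abs_add_le _ _).trans ?_
      rw [abs_neg, abs_neg, abs_mul, abs_mul]
      have := hq s hs'
      have := hqq s hs'
      have := hb s hs'
      gcongr)
    (by simp [h0]) (by simp [h0']) t ht
  simpa using this

/-- Near the limit `ε = κ = 0` the Duffing solution still has a zero `h` close to the first zero `b`
of the limit solution, and the sign of `X (1 - X)` at `h` is the sign at `b` for the limit. -/
theorem exists_sign_persists {ψ₀ ψ₀' : ℝ → ℝ} (h₀ : IsDuffing 0 ψ₀ ψ₀') {b : ℝ} (hb : 0 < b)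
    (hψb : ψ₀ b = 0) (hpos : ∀ t ∈ Ico 0 b, 0 < ψ₀ t) (hneg : ψ₀' b < 0) {γ τ : ℝ}
    {c₀ c₀' s₀ s₀' : ℝ → ℝ} (hf₀ : IsFundamental (fun t => γ * ψ₀ t ^ 2) c₀ c₀' s₀ s₀')
    (hτ : 0 < τ * ((c₀ b * s₀' b) * (1 - c₀ b * s₀' b))) :
    ∃ ε₀ > 0, ε₀ ≤ 1 ∧ ∀ ε κ : ℝ, 0 ≤ ε → ε ≤ ε₀ → 0 ≤ κ → κ ≤ ε₀ → ∀ ψ ψ' : ℝ → ℝ,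
      IsDuffing ε ψ ψ' → ∀ c c' s s' : ℝ → ℝ, IsFundamental (fun t => κ + γ * ψ t ^ 2) c c' s s' →
        ∃ h > 0, ψ h = 0 ∧ 0 < τ * ((c h * s' h) * (1 - c h * s' h)) := by
  -- the sign condition is open in `(c, s')`
  have hopen : IsOpen {z : ℝ × ℝ | 0 < τ * ((z.1 * z.2) * (1 - z.1 * z.2))} :=
    isOpen_lt continuous_const (by fun_prop)
  obtain ⟨η, hη, hball⟩ := Metric.isOpen_iff.1 hopen (c₀ b, s₀' b) hτ
  have hev : ∀ᶠ t in nhds b, |c₀ t - c₀ b| < η / 2 ∧ |s₀' t - s₀' b| < η / 2 ∧ ψ₀' t < 0 := by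
    refine ((Metric.tendsto_nhds.1 (hf₀.cosine.continuous.tendsto b) (η / 2) (by positivity)).and
      ((Metric.tendsto_nhds.1 (hf₀.sine.continuous'.tendsto b) (η / 2) (by positivity)).and
      ((h₀.continuous'.tendsto b).eventually_lt_const hneg)))
  obtain ⟨ρ', hρ', hρ'ball⟩ := Metric.eventually_nhds_iff.1 hev
  obtain ⟨ρ, hρ, hρb, hρlt⟩ : ∃ ρ > 0, ρ ≤ b ∧ ρ < ρ' :=
    ⟨min b (ρ' / 2), by positivity, min_le_left _ _,
      (min_le_right _ _).trans_lt (by linarith)⟩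
  have hnear : ∀ t ∈ Icc (b - ρ) (b + ρ),
      |c₀ t - c₀ b| < η / 2 ∧ |s₀' t - s₀' b| < η / 2 ∧ ψ₀' t < 0 := fun t ht =>
    hρ'ball (by rw [Real.dist_eq, abs_lt]; constructor <;> linarith [ht.1, ht.2])
  have hleft : 0 < ψ₀ (b - ρ) := hpos _ ⟨by linarith, by linarith⟩
  have hright : ψ₀ (b + ρ) < 0 := by
    have hanti : StrictAntiOn ψ₀ (Icc b (b + ρ)) :=
      strictAntiOn_of_deriv_neg (convex_Icc _ _) h₀.continuous.continuousOn fun t ht => by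
        rw [interior_Icc] at ht
        rw [(h₀.deriv t).deriv]
        exact (hnear t ⟨by linarith [ht.1], ht.2.le⟩).2.2
    have := hanti ⟨le_rfl, by linarith⟩ ⟨by linarith, le_rfl⟩ (by linarith)
    rwa [hψb] at this
  set T := b + ρ with hT
  obtain ⟨M₁, hM₁⟩ := isCompact_Icc.exists_bound_of_continuousOn (s := Icc 0 T)
    hf₀.cosine.continuous.continuousOn
  obtain ⟨M₂, hM₂⟩ := isCompact_Icc.exists_bound_of_continuousOn (s := Icc 0 T)
    hf₀.sine.continuous.continuousOn
  set M := |M₁| + |M₂| with hM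
  set L := 1 + 2 * |γ| * Real.exp (3 * T) with hL
  set G := Real.exp ((1 + |γ|) * T) with hG
  have hM0 : 0 ≤ M := by positivity
  have hL0 : 0 < L := by positivity
  have hG0 : 0 < G := Real.exp_pos _
  have hE0 : 0 < Real.exp (3 * T) := Real.exp_pos _
  obtain ⟨ε₀, hε₀, he1, heL, hel, her⟩ : ∃ ε₀ > 0, ε₀ ≤ 1 ∧ ε₀ * (L * M * G) < η / 2 ∧
      ε₀ * Real.exp (3 * T) < ψ₀ (b - ρ) ∧ ε₀ * Real.exp (3 * T) < -ψ₀ (b + ρ) := by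
    have t1 : ∀ k μ : ℝ, 0 < μ → ∀ᶠ e in nhdsWithin (0 : ℝ) (Ioi 0), e * k < μ := by
      intro k μ hμ
      have : Filter.Tendsto (fun e : ℝ => e * k) (nhds 0) (nhds (0 * k)) :=
        (continuous_id.mul continuous_const).tendsto 0
      rw [zero_mul] at this
      exact (this.eventually_lt_const hμ).filter_mono nhdsWithin_le_nhds
    obtain ⟨e, ⟨e1, e2, e3, e4⟩, e5⟩ := ((t1 1 1 one_pos).and ((t1 (L * M * G) (η / 2)
      (by positivity)).and ((t1 _ _ hleft).and (t1 _ _ (neg_pos.2 hright))))).and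
      self_mem_nhdsWithin |>.exists
    exact ⟨e, e5, by linarith, e2, e3, e4⟩
  refine ⟨ε₀, hε₀, he1, fun ε κ hε hεε hκ hκε ψ ψ' hψ c c' s s' hf => ?_⟩
  have hclose : ∀ t ∈ Icc 0 T, |ψ t - ψ₀ t| ≤ ε₀ * Real.exp (3 * T) := fun t ht =>
    (hψ.abs_sub_le hε h₀ ht).trans (by gcongr)
  have hl : 0 < ψ (b - ρ) := by
    have := abs_le.1 (hclose (b - ρ) ⟨by linarith, by linarith⟩)
    linarith [this.1]
  have hr : ψ (b + ρ) < 0 := by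
    have := abs_le.1 (hclose (b + ρ) ⟨by linarith, le_rfl⟩)
    linarith [this.2]
  obtain ⟨h, hh, hh0⟩ := intermediate_value_Icc' (a := b - ρ) (b := b + ρ) (by linarith)
    hψ.continuous.continuousOn ⟨hr.le, hl.le⟩
  have hhρ : b - ρ ≠ h := by rintro rfl; exact hl.ne' hh0
  have hhpos : 0 < h := by
    have := lt_of_le_of_ne hh.1 hhρ
    linarith
  refine ⟨h, hhpos, hh0, ?_⟩
  have hhT : h ∈ Icc 0 T := ⟨hhpos.le, hh.2⟩
  have hsq : ∀ t, |ψ t ^ 2| ≤ 1 := fun t => by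
    rw [abs_pow]; exact pow_le_one₀ (abs_nonneg _) (hψ.abs_le_one hε t)
  have hqK : ∀ t ∈ Icc 0 T, |κ + γ * ψ t ^ 2| ≤ 1 + |γ| := fun t _ => by
    refine (abs_add_le _ _).trans ?_
    rw [abs_of_nonneg hκ, abs_mul]
    have := mul_le_of_le_one_right (abs_nonneg γ) (hsq t)
    linarith
  have hqq : ∀ t ∈ Icc 0 T, |κ + γ * ψ t ^ 2 - γ * ψ₀ t ^ 2| ≤ ε₀ * L := fun t ht => by
    rw [show κ + γ * ψ t ^ 2 - γ * ψ₀ t ^ 2 = κ + γ * ((ψ t + ψ₀ t) * (ψ t - ψ₀ t)) by ring]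
    refine (abs_add_le _ _).trans ?_
    rw [abs_of_nonneg hκ, abs_mul, abs_mul]
    have h2 : |ψ t + ψ₀ t| ≤ 2 := (abs_add_le _ _).trans (by
      linarith [hψ.abs_le_one hε t, h₀.abs_le_one le_rfl t])
    calc κ + |γ| * (|ψ t + ψ₀ t| * |ψ t - ψ₀ t|)
        ≤ ε₀ + |γ| * (2 * (ε₀ * Real.exp (3 * T))) := by
          gcongr
          exact hclose t ht
      _ = ε₀ * L := by rw [hL]; ring
  have hK1 : 1 ≤ 1 + |γ| := by linarith [abs_nonneg γ]
  have d1 := (hf.cosine.abs_sub_le hf₀.cosine (by rw [hf.c_zero, hf₀.c_zero])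
    (by rw [hf.c'_zero, hf₀.c'_zero]) hK1 (by positivity) hM0 hqK hqq (fun t ht => by
      have := hM₁ t ht
      rw [Real.norm_eq_abs] at this
      linarith [le_abs_self M₁, abs_nonneg M₂]) h hhT).1
  have d2 := (hf.sine.abs_sub_le hf₀.sine (by rw [hf.s_zero, hf₀.s_zero])
    (by rw [hf.s'_zero, hf₀.s'_zero]) hK1 (by positivity) hM0 hqK hqq (fun t ht => by
      have := hM₂ t ht
      rw [Real.norm_eq_abs] at this
      linarith [le_abs_self M₂, abs_nonneg M₁]) h hhT).2
  have e : ε₀ * L * M * Real.exp ((1 + |γ|) * T) = ε₀ * (L * M * G) := by rw [hG]; ring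
  rw [e] at d1 d2
  obtain ⟨n1, n2, -⟩ := hnear h hh
  refine hball (a := (c h, s' h)) ?_
  rw [Metric.mem_ball, Prod.dist_eq, max_lt_iff, Real.dist_eq, Real.dist_eq]
  constructor
  · calc |c h - c₀ b| ≤ |c h - c₀ h| + |c₀ h - c₀ b| := abs_sub_le _ _ _
      _ < η := by linarith
  · calc |s' h - s₀' b| ≤ |s' h - s₀' h| + |s₀' h - s₀' b| := abs_sub_le _ _ _
      _ < η := by linarith

/-! ### Rescaling at high energy -/

/-- Along a solution `φ` of high energy, the Hill equation with coefficient `κ + γ β φ²` is an affine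
change of time in a symmetric Hill equation close to the limit equation. -/
theorem exists_rescaling {ψ₀ ψ₀' : ℝ → ℝ} (h₀ : IsDuffing 0 ψ₀ ψ₀') {b : ℝ} (hb : 0 < b)
    (hψb : ψ₀ b = 0) (hpos : ∀ t ∈ Ico 0 b, 0 < ψ₀ t) (hneg : ψ₀' b < 0) {γ τ : ℝ}
    {c₀ c₀' s₀ s₀' : ℝ → ℝ} (hf₀ : IsFundamental (fun t => γ * ψ₀ t ^ 2) c₀ c₀' s₀ s₀')
    (hτ : 0 < τ * ((c₀ b * s₀' b) * (1 - c₀ b * s₀' b))) {α κ β : ℝ} (hα : 0 < α) (hκ : 0 < κ)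
    (hβ : 0 < β) :
    ∃ E : ℝ, ∀ φ φ' : ℝ → ℝ, (∀ t ∈ Ici (0 : ℝ), HasDerivWithinAt φ (φ' t) (Ici 0) t ∧
        HasDerivWithinAt φ' (-α * φ t - β * φ t ^ 3) (Ici 0) t) →
      E ≤ φ' 0 ^ 2 / 2 + α * (φ 0 ^ 2 / 2) + β * (φ 0 ^ 4 / 4) →
      ∃ (q c c' s s' : ℝ → ℝ) (h ω t₀ : ℝ), IsFundamental q c c' s s' ∧ (∀ t, q (-t) = q t) ∧
        (∀ t, q (2 * h - t) = q t) ∧ 0 < h ∧ 0 < ω ∧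
        0 < τ * ((c h * s' h) * (1 - c h * s' h)) ∧
        ∀ t ≥ 0, κ + γ * β * φ t ^ 2 = ω ^ 2 * q (ω * t + t₀) := by
  obtain ⟨ε₀, hε₀, he1, key⟩ := exists_sign_persists h₀ hb hψb hpos hneg hf₀ hτ
  set Y := (α + κ) / ε₀ with hY
  have hY0 : 0 < Y := by positivity
  refine ⟨(α + Y) ^ 2 / (4 * β), fun φ φ' hφ hE => ?_⟩
  set E := φ' 0 ^ 2 / 2 + α * (φ 0 ^ 2 / 2) + β * (φ 0 ^ 4 / 4) with hEdef
  -- `ω²` is the root of `y² + 2 α y = 4 β E`, so that the orbit has amplitude `A = ω / √β`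
  have hE' : (α + Y) ^ 2 ≤ α ^ 2 + 4 * β * E := by
    rw [div_le_iff₀ (by positivity)] at hE
    nlinarith
  set R := √(α ^ 2 + 4 * β * E) with hR
  have hRY : α + Y ≤ R := Real.le_sqrt_of_sq_le hE'
  have hR2 : R ^ 2 = α ^ 2 + 4 * β * E := Real.sq_sqrt ((sq_nonneg _).trans hE')
  have hW : 0 < R - α := by linarith
  obtain ⟨ω, hω, hω2⟩ : ∃ ω > 0, ω ^ 2 = R - α := ⟨√(R - α), Real.sqrt_pos.2 hW, Real.sq_sqrt hW.le⟩
  obtain ⟨A, hA, hA2⟩ : ∃ A > 0, ω ^ 2 = β * A ^ 2 := by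
    refine ⟨√(ω ^ 2 / β), by positivity, ?_⟩
    rw [Real.sq_sqrt (by positivity)]
    field_simp
  have hω0 : ω ^ 2 ≠ 0 := by positivity
  have hbound : ∀ x, 0 < x → x ≤ α + κ → x / ω ^ 2 ≤ ε₀ := by
    intro x _ hx
    rw [div_le_iff₀ (by positivity), hω2]
    have : Y * ε₀ = α + κ := by rw [hY]; field_simp
    nlinarith
  set ε := α / ω ^ 2 with hε
  have hε0 : 0 ≤ ε := by positivity
  have hεle : ε ≤ ε₀ := hbound α hα (by linarith)
  have hεω : ε * ω ^ 2 = α := by rw [hε]; field_simp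
  obtain ⟨ψ, ψ', hψ⟩ := exists_isDuffing hε0 (hεle.trans he1)
  obtain ⟨c, c', s, s', hf⟩ := exists_isFundamental (q := fun t => κ / ω ^ 2 + γ * ψ t ^ 2)
    (B := κ / ω ^ 2 + |γ|) (by have := hψ.continuous; fun_prop) (fun t => by
      have h1 : |ψ t ^ 2| ≤ 1 := by
        rw [abs_pow]; exact pow_le_one₀ (abs_nonneg _) (hψ.abs_le_one hε0 t)
      refine (abs_add_le _ _).trans ?_
      rw [abs_of_nonneg (by positivity : 0 ≤ κ / ω ^ 2), abs_mul]
      have := mul_le_of_le_one_right (abs_nonneg γ) h1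
      linarith)
  obtain ⟨h, hh, hψh, hsign⟩ := key ε (κ / ω ^ 2) hε0 hεle (by positivity)
    (hbound κ hκ (by linarith)) ψ ψ' hψ c c' s s' hf
  have hlevel : (φ' 0 / (A * ω)) ^ 2 + ε * (φ 0 / A) ^ 2 + (φ 0 / A) ^ 4 / 2 = ε + 1 / 2 := by
    have h1 : φ' 0 ^ 2 + α * φ 0 ^ 2 + β * φ 0 ^ 4 / 2 = α * A ^ 2 + β * A ^ 4 / 2 := by
      have e1 : (β * A ^ 2 + α) ^ 2 = α ^ 2 + 4 * β * E := by
        rw [← hA2, hω2, sub_add_cancel, hR2]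
      refine mul_left_cancel₀ (b := _) hβ.ne' ?_
      rw [hEdef] at e1
      linear_combination (-1 / 2) * e1
    have h2 : A ^ 2 * ω ^ 2 ≠ 0 := by positivity
    refine mul_left_cancel₀ h2 ?_
    have e2 : A ^ 2 * ω ^ 2 * ((φ' 0 / (A * ω)) ^ 2 + ε * (φ 0 / A) ^ 2 + (φ 0 / A) ^ 4 / 2)
        = φ' 0 ^ 2 + (ε * ω ^ 2) * φ 0 ^ 2 + ω ^ 2 / A ^ 2 * φ 0 ^ 4 / 2 := by
      field_simp
    have e3 : ω ^ 2 / A ^ 2 = β := by rw [hA2]; field_simp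
    rw [e2, hεω, e3, h1]
    linear_combination (-A ^ 2) * hεω - A ^ 2 / 2 * hA2
  obtain ⟨t₀, ht₀, ht₀'⟩ := hψ.exists_phase hε0 hh hψh hlevel
  have hφψ : ∀ t ≥ 0, φ t = A * ψ (ω * t + t₀) := fun t ht => by
    have hx := fun t => hψ.comp_affine (b := t₀) hεω hA2 t
    refine (duffing_unique hφ
      (fun t _ => ⟨(hx t).1.hasDerivWithinAt, (hx t).2.hasDerivWithinAt⟩) ?_ ?_ ht).1
    · rw [mul_zero, zero_add, ht₀]; field_simp
    · rw [mul_zero, zero_add, ht₀']; field_simp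
  refine ⟨_, c, c', s, s', h, ω, t₀, hf, fun t => by simp only [(hψ.even t).1],
    fun t => by simp only [hψ.reflect hψh, neg_sq], hh, hω, hsign, fun t ht => ?_⟩
  rw [hφψ t ht]
  have : ω ^ 2 * (κ / ω ^ 2) = κ := by field_simp
  linear_combination (-1) * this - γ * ψ (ω * t + t₀) ^ 2 * hA2

theorem IsLinearSolution.rescaled_isHillSolution {q u u' a : ℝ → ℝ} {ω t₀ : ℝ}
    (h : IsLinearSolution q u u') (ha : ∀ t ≥ 0, a t = ω ^ 2 * q (ω * t + t₀)) :
    Plate.IsHillSolution a (fun t => u (ω * t + t₀)) (fun t => ω * u' (ω * t + t₀)) := by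
  intro t ht
  have := (h.comp_affine ω t₀).isHillSolution t ht
  rwa [← ha t ht] at this

namespace IsFundamental

variable {q c c' s s' a : ℝ → ℝ} {h ω t₀ : ℝ}

theorem rescaled_stable (hf : IsFundamental q c c' s s') (hq0 : ∀ t, q (-t) = q t)
    (hqh : ∀ t, q (2 * h - t) = q t) (hh : 0 < h) (hω : 0 < ω)
    (hX : 0 < (c h * s' h) * (1 - c h * s' h)) (ha : ∀ t ≥ 0, a t = ω ^ 2 * q (ω * t + t₀)) :
    Plate.HillStable a ∧ Plate.HillBounded a := by
  obtain ⟨B, hB⟩ := hf.exists_bound hq0 hqh hh hX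
  have hB0 : 0 ≤ B := (abs_nonneg _).trans (hB 0).1
  refine Plate.stable_of_bounded_solutions (hf.cosine.rescaled_isHillSolution ha)
    (hf.sine.rescaled_isHillSolution ha) ?_ (B := B * (1 + ω)) fun t _ => ?_
  · have := hf.wronskian (ω * 0 + t₀)
    rw [show c (ω * 0 + t₀) * (ω * s' (ω * 0 + t₀)) - ω * c' (ω * 0 + t₀) * s (ω * 0 + t₀) = ω by
      linear_combination ω * this]
    exact hω.ne'
  · obtain ⟨b1, b2, b3, b4⟩ := hB (ω * t + t₀)
    rw [abs_mul, abs_mul, abs_of_pos hω]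
    refine ⟨?_, ?_, ?_, ?_⟩ <;> nlinarith

theorem rescaled_unstable (hf : IsFundamental q c c' s s') (hq0 : ∀ t, q (-t) = q t)
    (hqh : ∀ t, q (2 * h - t) = q t) (hh : 0 < h) (hω : 0 < ω)
    (hX : (c h * s' h) * (1 - c h * s' h) < 0) (ha : ∀ t ≥ 0, a t = ω ^ 2 * q (ω * t + t₀)) :
    ¬ Plate.HillStable a ∧ ¬ Plate.HillBounded a := by
  obtain ⟨r, hr⟩ := hf.exists_unbounded hq0 hqh hh hX
  refine Plate.unstable_of_unbounded_solution
    ((hf.cosine.combination hf.sine 1 r).rescaled_isHillSolution ha) fun C => ?_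
  obtain ⟨t, ht, hC⟩ := hr C t₀
  refine ⟨(t - t₀) / ω, div_nonneg (by linarith) hω.le, ?_⟩
  rw [mul_div_cancel₀ _ hω.ne', sub_add_cancel, one_mul]
  exact hC

end IsFundamental

theorem exists_exponent {γ : ℝ} (hγ : 0 ≤ γ) : ∃ p : ℝ, 0 ≤ p ∧ p * (p + 1) / 2 = γ := by
  have h := Real.sq_sqrt (show 0 ≤ 1 + 8 * γ by linarith)
  have h1 : 1 ≤ √(1 + 8 * γ) := Real.one_le_sqrt.2 (by linarith)
  exact ⟨(√(1 + 8 * γ) - 1) / 2, by linarith, by linear_combination h / 8⟩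

/-- A solution of the limit equation with its first zero and the sign of `X (1 - X)` there. -/
theorem exists_limit_data {γ : ℝ} (hγ : 0 ≤ γ) :
    ∃ (ψ ψ' c c' s s' : ℝ → ℝ) (b : ℝ), IsDuffing 0 ψ ψ' ∧ 0 < b ∧ ψ b = 0 ∧
      (∀ t ∈ Ico 0 b, 0 < ψ t) ∧ ψ' b < 0 ∧ IsFundamental (fun t => γ * ψ t ^ 2) c c' s s' ∧
      ∀ j : ℕ, (γ ∈ Plate.intervalI j → 0 < (c b * s' b) * (1 - c b * s' b)) ∧
        (γ ∈ Plate.intervalK j → (c b * s' b) * (1 - c b * s' b) < 0) := by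
  obtain ⟨p, hp0, hp⟩ := exists_exponent hγ
  obtain ⟨ψ, ψ', hψ⟩ := exists_isDuffing (le_refl (0 : ℝ)) zero_le_one
  obtain ⟨b, hb, hψb, hpos, hneg⟩ := hψ.exists_quarter_period
  obtain ⟨c, c', s, s', hf⟩ := exists_isFundamental (q := fun t => γ * ψ t ^ 2) (B := γ)
    (by have := hψ.continuous; fun_prop) (fun t => by
      have h1 : |ψ t ^ 2| ≤ 1 := by
        rw [abs_pow]; exact pow_le_one₀ (abs_nonneg _) (hψ.abs_le_one le_rfl t)
      rw [abs_mul, abs_of_nonneg hγ]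
      exact mul_le_of_le_one_right hγ h1)
  refine ⟨ψ, ψ', c, c', s, s', b, hψ, hb, hψb, hpos, hneg b ⟨hb, le_rfl⟩, hf, fun j => ?_⟩
  have hj : (0 : ℝ) ≤ j := Nat.cast_nonneg j
  subst hp
  have hs := limit_sign hψ hb hψb hpos hneg j p c c' s s' hf
  constructor
  · rintro ⟨h1, h2⟩
    refine hs.1 ⟨?_, ?_⟩
    · by_contra! hle; nlinarith
    · by_contra! hle; nlinarith
  · rintro ⟨h1, h2⟩
    refine hs.2 ⟨?_, ?_⟩
    · by_contra! hle; nlinarith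
    · by_contra! hle; nlinarith

theorem Plate.hillCoeff_eq {l σ P S : ℝ} {m n k : ℕ} (hm : 1 ≤ m) (φ : ℝ → ℝ) (t : ℝ) :
    hillCoeff l σ P S m n k φ t = n ^ 2 * (eigenvalue l σ n k - P)
      + (n : ℝ) ^ 2 / (m : ℝ) ^ 2 * (S * m ^ 4) * φ t ^ 2 := by
  have hm' : (m : ℝ) ≠ 0 := by positivity
  rw [hillCoeff]
  field_simp

theorem theorem4p1 (l σ S P : ℝ) (hl : 0 < l) (hσ : 0 < σ) (hσ' : σ < 1 / 2) (hS : 0 < S)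
    (m i n k : ℕ) (hm : 1 ≤ m) (hi : 1 ≤ i) (hn : 1 ≤ n) (hk : 1 ≤ k)
    (hP : P < min (Plate.eigenvalue l σ m i) (Plate.eigenvalue l σ n k)) :
    ((∃ j : ℕ, (n : ℝ) ^ 2 / (m : ℝ) ^ 2 ∈ Plate.intervalI j) →
      ∃ E : ℝ, ∀ (w : Plate.H2star l) (u₀ v₀ : ℝ) (φ : ℝ → ℝ),
        Plate.IsSimpleMode σ P S m i w u₀ v₀ φ →
        E ≤ Plate.energy l σ P S m i u₀ v₀ →
          Plate.IsLinearlyStable l σ P S m n k φ ∧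
          Plate.HillBounded (Plate.hillCoeff l σ P S m n k φ)) ∧
    ((∃ j : ℕ, (n : ℝ) ^ 2 / (m : ℝ) ^ 2 ∈ Plate.intervalK j) →
      ∃ E : ℝ, ∀ (w : Plate.H2star l) (u₀ v₀ : ℝ) (φ : ℝ → ℝ),
        Plate.IsSimpleMode σ P S m i w u₀ v₀ φ →
        E ≤ Plate.energy l σ P S m i u₀ v₀ →
          ¬ Plate.IsLinearlyStable l σ P S m n k φ ∧
          ¬ Plate.HillBounded (Plate.hillCoeff l σ P S m n k φ)) := by
  rw [lt_min_iff] at hP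
  have hm0 : (0 : ℝ) < m := by exact_mod_cast hm
  have hn0 : (0 : ℝ) < n := by exact_mod_cast hn
  have hα : 0 < (m : ℝ) ^ 2 * (Plate.eigenvalue l σ m i - P) :=
    mul_pos (by positivity) (by linarith [hP.1])
  have hκ : 0 < (n : ℝ) ^ 2 * (Plate.eigenvalue l σ n k - P) :=
    mul_pos (by positivity) (by linarith [hP.2])
  have hβ : 0 < S * (m : ℝ) ^ 4 := by positivity
  obtain ⟨ψ, ψ', c, c', s, s', b, hψ, hb, hψb, hpos, hneg, hf, hsign⟩ :=
    exists_limit_data (γ := (n : ℝ) ^ 2 / (m : ℝ) ^ 2) (by positivity)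
  have main : ∀ τ : ℝ, 0 < τ * ((c b * s' b) * (1 - c b * s' b)) →
      ∃ E : ℝ, ∀ (w : Plate.H2star l) (u₀ v₀ : ℝ) (φ : ℝ → ℝ),
        Plate.IsSimpleMode σ P S m i w u₀ v₀ φ → E ≤ Plate.energy l σ P S m i u₀ v₀ →
        ∃ (q c c' s s' : ℝ → ℝ) (h ω t₀ : ℝ), IsFundamental q c c' s s' ∧ (∀ t, q (-t) = q t) ∧
          (∀ t, q (2 * h - t) = q t) ∧ 0 < h ∧ 0 < ω ∧
          0 < τ * ((c h * s' h) * (1 - c h * s' h)) ∧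
          ∀ t ≥ 0, Plate.hillCoeff l σ P S m n k φ t = ω ^ 2 * q (ω * t + t₀) := by
    intro τ hτ
    obtain ⟨E, hE⟩ := exists_rescaling hψ hb hψb hpos hneg hf hτ hα hκ hβ
    refine ⟨E, fun w u₀ v₀ φ hφ hen => ?_⟩
    obtain ⟨φ', h0, h0', hode⟩ := hφ.duffing hm
    obtain ⟨q, c, c', s, s', h, ω, t₀, h1, h2, h3, h4, h5, h6, h7⟩ := hE φ φ' hode (by
      rw [h0, h0']
      refine hen.trans (le_of_eq ?_)
      rw [Plate.energy]
      ring)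
    exact ⟨q, c, c', s, s', h, ω, t₀, h1, h2, h3, h4, h5, h6, fun t ht => by
      rw [Plate.hillCoeff_eq hm, h7 t ht]⟩
  constructor
  · rintro ⟨j, hj⟩
    obtain ⟨E, hE⟩ := main 1 (by linarith [(hsign j).1 hj])
    refine ⟨E, fun w u₀ v₀ φ hφ hen => ?_⟩
    obtain ⟨q, c, c', s, s', h, ω, t₀, h1, h2, h3, h4, h5, h6, h7⟩ := hE w u₀ v₀ φ hφ hen
    exact h1.rescaled_stable h2 h3 h4 h5 (by linarith) h7
  · rintro ⟨j, hj⟩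
    obtain ⟨E, hE⟩ := main (-1) (by linarith [(hsign j).2 hj])
    refine ⟨E, fun w u₀ v₀ φ hφ hen => ?_⟩
    obtain ⟨q, c, c', s, s', h, ω, t₀, h1, h2, h3, h4, h5, h6, h7⟩ := hE w u₀ v₀ φ hφ hen
    exact h1.rescaled_unstable h2 h3 h4 h5 (by linarith) h7
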